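/- Let $1\le k\le N$ be integers, $0<\eta<1$, $0<\underline v\le 1$ and $I=[\underline v,1]$. In the $\eta$-noisy Bayesian persuasion game with $k$ selections, each agent $i\in[N]$ has a prior $\mathcal F_i$, an arbitrary probability measure on $I$, and a utility function $u_i:I\to(0,\infty)$ that is continuous and weakly increasing. A strategy (signaling scheme) of agent $i$ is a probability measure $\pi_i$ on $I\times I$, the joint law of a value $v_i$ and a message $m_i$, whose first marginal is $\mathcal F_i$ and for which $\mathbb E[v_i\mid m_i]=m_i$, i.e. $\int (v-m)\,h(m)\,d\pi_i(v,m)=0$ for every continuous $h:I\to\mathbb R$. Given a strategy profile $\pi=(\pi_1,\dots,\pi_N)$, the pairs $(v_i,m_i)\sim\pi_i$ and the noises $\xi_i\sim\mathrm{Uniform}[1-\eta,1+\eta]$ are all drawn independently; the principal observes $y_i=m_i\xi_i$ and selects the $k$ agents with the highest $y_i$, breaking ties uniformly. Let $\rho_i$ be the resulting probability that $i$ is selected given $(m,\xi)$. The expected utility of agent $i$ is $U_i(\pi)=\mathbb E[\rho_i\,u_i(v_i)]$, and the expected social welfare is $\mathrm{SW}(\pi)=\mathbb E\big[\sum_{i}\rho_i\,m_i\big]$.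 A profile $\pi$ is a Nash equilibrium if no agent $i$ can increase $U_i$ by changing only her own signaling scheme. The first-best welfare is $\mathrm{SW}^{\max}=\mathbb E_{v\sim\mathcal F_1\otimes\cdots\otimes\mathcal F_N}\big[\max_{S\subseteq[N],\,|S|=k}\sum_{i\in S}v_i\big]$, and the price of anarchy is $$\mathrm{PoA}=\frac{\mathrm{SW}^{\max}}{\inf\{\mathrm{SW}(\pi):\pi\text{ is a Nash equilibrium}\}}\in[0,\infty],$$ with the infimum of the empty set read as $+\infty$ (and then $\mathrm{PoA}=0$). Theorem. For every such game, $$\mathrm{PoA}\le(11+5\sqrt5)\left(\frac{1+\eta}{1-\eta}\right)^2 .$$ -/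

import Mathlib

open MeasureTheory ProbabilityTheory

namespace NoisyPersuasion

/-- An instance of the noisy Bayesian persuasion game with `N` agents and `k` selections. Values
and messages live in `I = [lo, 1]`; measures and functions on `I` are represented by measures on
`ℝ` that are carried by `I` and by the behaviour on `I` of functions on `ℝ`. -/
structure Game (N k : ℕ) where
  /-- the lower end of the value space -/
  lo : ℝ
  /-- the noise level -/
  η : ℝ
  /-- the prior distribution of each agent's value -/
  prior : Fin N → Measure ℝ
  /-- the utility of each agent when selected, as a function of her value -/
  u : Fin N → ℝ → ℝ
  one_le_k : 1 ≤ k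
  k_le_N : k ≤ N
  lo_pos : 0 < lo
  η_pos : 0 < η
  η_lt_one : η < 1
  prior_prob : ∀ i, IsProbabilityMeasure (prior i)
  prior_supp : ∀ i, ∀ᵐ v ∂(prior i), v ∈ Set.Icc lo 1
  u_cont : ∀ i, ContinuousOn (u i) (Set.Icc lo 1)
  u_mono : ∀ i, MonotoneOn (u i) (Set.Icc lo 1)
  u_pos : ∀ i, ∀ v ∈ Set.Icc lo 1, 0 < u i v

/-- A signaling scheme for prior `F` on `[lo, 1]`: a joint law of (value, message) on
`[lo, 1] × [lo, 1]` whose value marginal is `F` and for which the conditional expectation of the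
value given the message is the message. -/
structure IsSignalingScheme (lo : ℝ) (F : Measure ℝ) (π : Measure (ℝ × ℝ)) : Prop where
  prob : IsProbabilityMeasure π
  supp : ∀ᵐ p ∂π, p.1 ∈ Set.Icc lo 1 ∧ p.2 ∈ Set.Icc lo 1
  marginal : ∀ A : Set ℝ, MeasurableSet A → π (Prod.fst ⁻¹' A) = F A
  posterior : ∀ h : ℝ → ℝ, ContinuousOn h (Set.Icc lo 1) → ∫ p, (p.1 - p.2) * h p.2 ∂π = 0

/-- The uniform distribution on `[1 - η, 1 + η]`. -/
noncomputable def noise (η : ℝ) : Measure ℝ :=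
  ProbabilityTheory.cond volume (Set.Icc (1 - η) (1 + η))

/-- The probability that agent `i` is among the `k` selected agents when the observed values are
`y`: the agents with the `k` highest observed values are selected, ties are broken uniformly. -/
noncomputable def selProb {N : ℕ} (k : ℕ) (y : Fin N → ℝ) (i : Fin N) : ℝ :=
  if (Finset.univ.filter fun j => y i ≤ y j).card ≤ k then 1
  else max 0 ((k : ℝ) - ((Finset.univ.filter fun j => y i < y j).card : ℝ)) /
    ((Finset.univ.filter fun j => y j = y i).card : ℝ)

/-- An outcome assigns to each agent her value, message and noise, as `((v, m), ξ)`. -/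
abbrev Outcome (N : ℕ) : Type := Fin N → (ℝ × ℝ) × ℝ

namespace Outcome

variable {N : ℕ}

def value (ω : Outcome N) (i : Fin N) : ℝ := (ω i).1.1

def message (ω : Outcome N) (i : Fin N) : ℝ := (ω i).1.2

def observed (ω : Outcome N) (i : Fin N) : ℝ := (ω i).1.2 * (ω i).2

end Outcome

namespace Game

variable {N k : ℕ} (G : Game N k)

/-- Profiles of signaling schemes, one for each agent. -/
def IsProfile (π : Fin N → Measure (ℝ × ℝ)) : Prop :=
  ∀ i, IsSignalingScheme G.lo (G.prior i) (π i)

/-- The law of the outcome under `π`: the pairs `(v_i, m_i) ∼ π i` and the noises are all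
independent. -/
noncomputable def outcomeLaw (π : Fin N → Measure (ℝ × ℝ)) : Measure (Outcome N) :=
  Measure.pi fun i => (π i).prod (noise G.η)

/-- The expected utility of agent `i`. -/
noncomputable def utility (π : Fin N → Measure (ℝ × ℝ)) (i : Fin N) : ℝ :=
  ∫ ω, selProb k ω.observed i * G.u i (ω.value i) ∂(G.outcomeLaw π)

/-- The expected social welfare: the expected sum of the posterior means `m_i` of the agents whom
the principal selects on the basis of the noisy observations. -/
noncomputable def welfare (π : Fin N → Measure (ℝ × ℝ)) : ℝ :=
  ∫ ω, ∑ i, selProb k ω.observed i * ω.message i ∂(G.outcomeLaw π)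

/-- Nash equilibrium: no agent gains by switching to another signaling scheme. -/
def IsNash (π : Fin N → Measure (ℝ × ℝ)) : Prop :=
  G.IsProfile π ∧ ∀ (i : Fin N) (π' : Measure (ℝ × ℝ)),
    IsSignalingScheme G.lo (G.prior i) π' →
      G.utility (Function.update π i π') i ≤ G.utility π i

/-- The first-best welfare `𝔼 [max_{|S| = k} ∑_{i ∈ S} v_i]`. -/
noncomputable def firstBest : ℝ :=
  ∫ v : Fin N → ℝ, (⨆ S : {S : Finset (Fin N) // S.card = k}, ∑ i ∈ S.1, v i)
    ∂(Measure.pi G.prior)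

/-- The price of anarchy: first-best welfare over the infimum of the welfare of the equilibria. -/
noncomputable def priceOfAnarchy : ENNReal :=
  ENNReal.ofReal G.firstBest /
    ⨅ (π : Fin N → Measure (ℝ × ℝ)) (_ : G.IsNash π), ENNReal.ofReal (G.welfare π)

end Game

end NoisyPersuasion

namespace NoisyPersuasion

/-! ### The selection rule for fixed observations. -/

section Selection

variable {N : ℕ} (k : ℕ) (y : Fin N → ℝ)

/-! Let `W` be the welfare of an equilibrium, `r = (1 + η) / (1 - η)` and `T = 2 r W / k`. The proof
yields the bound `8 r`, which is stronger than the claimed one.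

Under any profile, a message `m ≥ T` is observed as at least `s = 2 (1 + η) W / k`, whatever its
noise. If `k` agents are observed at `s` or above, then the selected observations sum to at least `k
s`. The expected sum is at most `(1 + η) W`, so by Markov this has probability at most `1/2`, and
such a message is selected with probability at least `1/2` (`half_le_interim`).

Let `g m` be the selection probability of agent `i` at message `m`. Equilibrium then forces `E (v_i
- T)⁺ ≤ 2 E[g m_i] + 2 T E[g]`, where `E[g m_i]` means `E[g(m_i) m_i]` (`integral_excess_le`).
Messages above `T` give the first term, since they are selected half the time and their mean value
is the message. For messages below `T` with `g ≤ γ`, the agent could pool all values above `T` with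
enough lower ones to send the message `T`. As `u` is increasing, the pool carries at least its
proportional share of utility, so if the deviation does not pay, the pool is at most a fraction `2
γ` of these messages. Its mean value is `T`, which bounds the excess it contains
(`integral_excess_le_of_level`).

Summed over agents, `E[g m_i]` gives `W` and `E[g]` gives `k`. The first best is at most `k T` plus
the total excess, hence at most `3 k T + 2 W = 6 r W + 2 W ≤ 8 r W`. -/

lemma card_ge_eq_card_gt_add_card_eq (t : ℝ) :
    (Finset.univ.filter fun j => t ≤ y j).card =
      (Finset.univ.filter fun j => t < y j).card + (Finset.univ.filter fun j => y j = t).card := by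
  rw [← Finset.card_union_of_disjoint]
  · congr 1
    ext j
    simp only [Finset.mem_filter, Finset.mem_univ, true_and, Finset.mem_union]
    rw [le_iff_lt_or_eq, eq_comm (a := t)]
  · rw [Finset.disjoint_filter]
    intro j _ h h'
    exact absurd h' h.ne'

lemma selProb_nonneg (i : Fin N) : 0 ≤ selProb k y i := by
  unfold selProb
  split_ifs
  · exact zero_le_one
  · positivity

lemma selProb_le_one (i : Fin N) : selProb k y i ≤ 1 := by
  unfold selProb
  split_ifs with h
  · exact le_rfl
  · rw [not_le, card_ge_eq_card_gt_add_card_eq] at h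
    have h' : (k : ℝ) < (Finset.univ.filter fun j => y i < y j).card +
        (Finset.univ.filter fun j => y j = y i).card := by exact_mod_cast h
    refine div_le_one_of_le₀ (max_le (by positivity) (by linarith)) (by positivity)

lemma selProb_eq_one {i : Fin N} (h : (Finset.univ.filter fun j => y i ≤ y j).card ≤ k) :
    selProb k y i = 1 := if_pos h

/-- Either there is room for everybody, or the selection has a marginal level: agents above it are
selected, agents below it are not, and the remaining slots go to the agents at that level. -/
lemma exists_marginal_agent :
    (N ≤ k ∧ ∀ i, selProb k y i = 1) ∨
      ∃ i₀, (∀ i, y i₀ < y i → selProb k y i = 1) ∧ (∀ i, y i < y i₀ → selProb k y i = 0) ∧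
        ∑ i with y i₀ ≤ y i, selProb k y i = k := by
  classical
  set bad : Finset (Fin N) :=
    Finset.univ.filter fun i => k < (Finset.univ.filter fun j => y i ≤ y j).card with hbad
  rcases bad.eq_empty_or_nonempty with h | h
  · left
    have hfull : ∀ i, (Finset.univ.filter fun j => y i ≤ y j).card ≤ k := by
      intro i
      by_contra hi
      have : i ∈ bad := by simpa [hbad] using hi
      simp [h] at this
    refine ⟨?_, fun i => selProb_eq_one k y (hfull i)⟩
    rcases Nat.eq_zero_or_pos N with rfl | hN
    · exact Nat.zero_le _
    · have : Nonempty (Fin N) := ⟨⟨0, hN⟩⟩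
      obtain ⟨i, -, hi⟩ := Finset.exists_min_image Finset.univ y Finset.univ_nonempty
      have := hfull i
      rwa [Finset.filter_true_of_mem (fun j _ => hi j (Finset.mem_univ j)), Finset.card_univ,
        Fintype.card_fin] at this
  · right
    obtain ⟨i₀, hi₀, hmax⟩ := Finset.exists_max_image bad y h
    have hk : k < (Finset.univ.filter fun j => y i₀ ≤ y j).card := by simpa [hbad] using hi₀
    have hfull : ∀ i, y i₀ < y i → (Finset.univ.filter fun j => y i ≤ y j).card ≤ k := by
      intro i hi
      by_contra hc
      have : i ∈ bad := by simpa [hbad] using hc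
      exact absurd (hmax i this) (not_le.mpr hi)
    have hgt : (Finset.univ.filter fun j => y i₀ < y j).card ≤ k := by
      rcases (Finset.univ.filter fun j => y i₀ < y j).eq_empty_or_nonempty with h0 | h0
      · simp [h0]
      · obtain ⟨i, hi, hmin⟩ := Finset.exists_min_image _ y h0
        refine le_trans (Finset.card_le_card ?_) (hfull i (by simpa using hi))
        intro j hj
        simpa using hmin j hj
    refine ⟨i₀, fun i hi => selProb_eq_one k y (hfull i hi), ?_, ?_⟩
    · intro i hi
      have hsub : (Finset.univ.filter fun j => y i₀ ≤ y j).card ≤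
          (Finset.univ.filter fun j => y i < y j).card := by
        refine Finset.card_le_card fun j hj => ?_
        simp only [Finset.mem_filter, Finset.mem_univ, true_and] at hj ⊢
        exact hi.trans_le hj
      have hle : (Finset.univ.filter fun j => y i < y j).card ≤
          (Finset.univ.filter fun j => y i ≤ y j).card := by
        refine Finset.card_le_card fun j hj => ?_
        simp only [Finset.mem_filter, Finset.mem_univ, true_and] at hj ⊢
        exact hj.le
      unfold selProb
      rw [if_neg (by omega), max_eq_left, zero_div]
      have : (k : ℝ) ≤ (Finset.univ.filter fun j => y i < y j).card := by
        exact_mod_cast (hk.trans_le hsub).le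
      linarith
    · have hsplit : (Finset.univ.filter fun i => y i₀ ≤ y i) =
          (Finset.univ.filter fun i => y i₀ < y i) ∪ (Finset.univ.filter fun i => y i = y i₀) := by
        ext j
        simp only [Finset.mem_filter, Finset.mem_univ, true_and, Finset.mem_union]
        rw [le_iff_lt_or_eq, eq_comm (a := y i₀)]
      have hdisj : Disjoint (Finset.univ.filter fun i => y i₀ < y i)
          (Finset.univ.filter fun i => y i = y i₀) := by
        rw [Finset.disjoint_filter]
        intro j _ h h'
        exact absurd h' h.ne'
      rw [hsplit, Finset.sum_union hdisj,
        Finset.sum_congr (s₂ := Finset.univ.filter fun i => y i₀ < y i) rfl (g := fun _ => (1 : ℝ))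
          (fun i hi => selProb_eq_one k y (hfull i (by simpa using hi))),
        Finset.sum_congr (s₂ := Finset.univ.filter fun i => y i = y i₀) rfl
          (g := fun _ => ((k : ℝ) - ((Finset.univ.filter fun j => y i₀ < y j).card : ℝ)) /
            ((Finset.univ.filter fun j => y j = y i₀).card : ℝ)) ?_]
      · have hpos : (0 : ℝ) < ((Finset.univ.filter fun j => y j = y i₀).card : ℝ) := by
          have : 0 < (Finset.univ.filter fun j => y j = y i₀).card :=
            Finset.card_pos.mpr ⟨i₀, by simp⟩
          exact_mod_cast this
        rw [Finset.sum_const, Finset.sum_const, nsmul_eq_mul, nsmul_eq_mul,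
          mul_div_cancel₀ _ hpos.ne']
        ring
      · intro i hi
        have hi' : y i = y i₀ := by simpa using hi
        have hgt' : (0 : ℝ) ≤ (k : ℝ) - ((Finset.univ.filter fun j => y i₀ < y j).card : ℝ) := by
          rw [sub_nonneg]
          exact_mod_cast hgt
        unfold selProb
        rw [hi', if_neg (not_le.mpr hk), max_eq_right hgt']

lemma sum_selProb (hk : k ≤ N) : ∑ i, selProb k y i = k := by
  rcases exists_marginal_agent k y with ⟨hN, h⟩ | ⟨i₀, -, h0, hs⟩
  · simp only [h, Finset.sum_const, Finset.card_univ, Fintype.card_fin, nsmul_eq_mul, mul_one]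
    exact_mod_cast le_antisymm hN hk
  · rw [← hs]
    symm
    refine Finset.sum_subset (Finset.subset_univ _) fun i _ hi => h0 i ?_
    simpa using hi

/-- If `s` is at most the marginal level, the agents from that level up already absorb all `k`
slots; if it is higher, everyone at or above `s` is certainly selected. -/
lemma le_sum_selProb_of_le_card (s : ℝ) (h : k ≤ (Finset.univ.filter fun j => s ≤ y j).card) :
    (k : ℝ) ≤ ∑ i with s ≤ y i, selProb k y i := by
  have hall : (∀ i, s ≤ y i → selProb k y i = 1) → (k : ℝ) ≤ ∑ i with s ≤ y i, selProb k y i := by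
    intro h1
    rw [Finset.sum_congr rfl (g := fun _ => (1 : ℝ)) (fun i hi => h1 i (by simpa using hi))]
    simpa using h
  rcases exists_marginal_agent k y with ⟨-, h1⟩ | ⟨i₀, h1, -, hs⟩
  · exact hall fun i _ => h1 i
  · rcases le_or_gt s (y i₀) with hle | hlt
    · rw [← hs]
      refine Finset.sum_le_sum_of_subset_of_nonneg (fun i hi => ?_)
        fun i _ _ => selProb_nonneg k y i
      simp only [Finset.mem_filter, Finset.mem_univ, true_and] at hi ⊢
      exact hle.trans hi
    · exact hall fun i hi => h1 i (hlt.trans_le hi)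

/-- After the update, only `i` and the fewer than `k` agents previously at or above `s` can be at or
above `t`. -/
lemma selProb_update_eq_one {s t : ℝ} {i : Fin N} (hst : s ≤ t)
    (h : (Finset.univ.filter fun j => s ≤ y j).card < k) :
    selProb k (Function.update y i t) i = 1 := by
  classical
  refine selProb_eq_one k _ ?_
  refine le_trans (Finset.card_le_card
    (t := insert i (Finset.univ.filter fun j => s ≤ y j)) fun j hj => ?_)
    ((Finset.card_insert_le _ _).trans h)
  by_cases hji : j = i
  · simp [hji]
  · simp only [Finset.mem_filter, Finset.mem_univ, true_and, Function.update_self,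
      Function.update_of_ne hji] at hj
    simp [hst.trans hj]

lemma measurable_card_filter {α : Type*} [MeasurableSpace α] (p : α → Fin N → Prop)
    [∀ a, DecidablePred (p a)] (hp : ∀ j, MeasurableSet {a | p a j}) :
    Measurable fun a => (Finset.univ.filter (p a)).card := by
  simp only [Finset.card_filter]
  exact Finset.measurable_sum _ fun j _ => Measurable.ite (hp j) measurable_const measurable_const

lemma measurable_selProb (i : Fin N) : Measurable fun y : Fin N → ℝ => selProb k y i := by
  have hge := measurable_card_filter (fun (y : Fin N → ℝ) j => y i ≤ y j)
    fun j => measurableSet_le (measurable_pi_apply i) (measurable_pi_apply j)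
  have hgt := measurable_card_filter (fun (y : Fin N → ℝ) j => y i < y j)
    fun j => measurableSet_lt (measurable_pi_apply i) (measurable_pi_apply j)
  have heq := measurable_card_filter (fun (y : Fin N → ℝ) j => y j = y i)
    fun j => measurableSet_eq_fun (measurable_pi_apply j) (measurable_pi_apply i)
  unfold selProb
  refine Measurable.ite (hge (measurableSet_Iic (a := k))) measurable_const ?_
  exact ((measurable_const.max (measurable_const.sub
    (measurable_from_top.comp hgt)))).div (measurable_from_top.comp heq)

end Selection

/-! ### Unilateral deviations and interim selection probabilities. -/

/-- Drawing all coordinates and then redrawing the `i`-th from `ν` gives the product law with factor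
`ν`: the discarded coordinate integrates to one, as a check on boxes shows. -/
lemma pi_update_eq_map {ι α : Type*} [Fintype ι] [DecidableEq ι] [MeasurableSpace α]
    (μ : ι → Measure α) [∀ i, IsProbabilityMeasure (μ i)] (i : ι) (ν : Measure α)
    [IsProbabilityMeasure ν] :
    Measure.pi (Function.update μ i ν) =
      ((Measure.pi μ).prod ν).map fun z => Function.update z.1 i z.2 := by
  have : ∀ j, IsProbabilityMeasure (Function.update μ i ν j) := by
    intro j
    by_cases h : j = i
    · subst h; simpa
    · rw [Function.update_of_ne h]; infer_instance
  refine Measure.pi_eq fun s hs => ?_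
  have hm : Measurable fun z : (ι → α) × α => Function.update z.1 i z.2 := measurable_update'
  rw [Measure.map_apply hm (MeasurableSet.univ_pi hs)]
  have hpre : (fun z : (ι → α) × α => Function.update z.1 i z.2) ⁻¹' Set.univ.pi s =
      (Set.univ.pi (Function.update s i Set.univ)) ×ˢ s i := by
    ext z
    simp only [Set.mem_preimage, Set.mem_pi, Set.mem_univ, true_imp_iff, Set.mem_prod]
    constructor
    · intro h
      refine ⟨fun j => ?_, by simpa using h i⟩
      by_cases hj : j = i
      · subst hj; simp
      · simpa [hj] using h j
    · rintro ⟨h, h'⟩ j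
      by_cases hj : j = i
      · subst hj; simpa using h'
      · simpa [hj] using h j
  rw [hpre, Measure.prod_prod, Measure.pi_pi,
    ← Finset.mul_prod_erase _ _ (Finset.mem_univ i), ← Finset.mul_prod_erase _ (fun j =>
      Function.update μ i ν j (s j)) (Finset.mem_univ i)]
  simp only [Function.update_self, measure_univ, one_mul]
  rw [mul_comm]
  congr 1
  refine Finset.prod_congr rfl fun j hj => ?_
  simp [Finset.ne_of_mem_erase hj]

lemma isProbabilityMeasure_noise {η : ℝ} (hη : 0 < η) : IsProbabilityMeasure (noise η) := by
  unfold noise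
  refine cond_isProbabilityMeasure_of_finite ?_ measure_Icc_lt_top.ne
  simp only [Real.volume_Icc, ne_eq, ENNReal.ofReal_eq_zero, not_le]
  linarith

lemma ae_noise_mem (η : ℝ) : ∀ᵐ ξ ∂(noise η), ξ ∈ Set.Icc (1 - η) (1 + η) :=
  ae_cond_mem measurableSet_Icc

lemma Outcome.measurable_observed {N : ℕ} :
    Measurable fun ω : Outcome N => ω.observed := by
  unfold Outcome.observed
  fun_prop

lemma Outcome.observed_update {N : ℕ} (ω : Outcome N) (i : Fin N) (x : (ℝ × ℝ) × ℝ) :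
    Outcome.observed (Function.update ω i x) = Function.update ω.observed i (x.1.2 * x.2) := by
  ext j
  by_cases h : j = i
  · subst h; simp [Outcome.observed]
  · simp [Outcome.observed, h]

namespace Game

variable {N k : ℕ} (G : Game N k)

/-- The probability that agent `i` is selected when she sends the message `m` and the other agents
follow `π`. -/
noncomputable def interim (π : Fin N → Measure (ℝ × ℝ)) (i : Fin N) (m : ℝ) : ℝ :=
  ∫ ξ, ∫ ω : Outcome N, selProb k (Function.update ω.observed i (m * ξ)) i
    ∂(G.outcomeLaw π) ∂(noise G.η)

instance : IsProbabilityMeasure (noise G.η) := isProbabilityMeasure_noise G.η_pos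

instance (π : Fin N → Measure (ℝ × ℝ)) [∀ i, IsProbabilityMeasure (π i)] :
    IsProbabilityMeasure (G.outcomeLaw π) := by
  unfold outcomeLaw
  infer_instance

lemma measurable_selProb_update (i : Fin N) :
    Measurable fun z : Outcome N × (ℝ × ℝ) =>
      selProb k (Function.update z.1.observed i (z.2.1 * z.2.2)) i := by
  have h1 : Measurable fun z : Outcome N × (ℝ × ℝ) => (z.1.observed, z.2.1 * z.2.2) :=
    (Outcome.measurable_observed.comp measurable_fst).prodMk (by fun_prop)
  exact (measurable_selProb k i).comp ((measurable_update' (a := i)).comp h1)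

lemma interim_nonneg (π : Fin N → Measure (ℝ × ℝ)) (i : Fin N) (m : ℝ) : 0 ≤ G.interim π i m :=
  integral_nonneg fun _ => integral_nonneg fun _ => selProb_nonneg _ _ _

section

variable (π : Fin N → Measure (ℝ × ℝ)) [∀ i, IsProbabilityMeasure (π i)] (i : Fin N)

lemma measurable_interim : Measurable (G.interim π i) := by
  have h1 : StronglyMeasurable fun x : ℝ × ℝ => ∫ ω : Outcome N,
      selProb k (Function.update ω.observed i (x.1 * x.2)) i ∂(G.outcomeLaw π) :=
    (measurable_selProb_update (k := k) i).stronglyMeasurable.integral_prod_left'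
  exact (h1.integral_prod_right' (ν := noise G.η)).measurable

lemma interim_le_one (m : ℝ) : G.interim π i m ≤ 1 := by
  unfold interim
  have h : ∀ ξ : ℝ, ∫ ω : Outcome N, selProb k (Function.update ω.observed i (m * ξ)) i
      ∂(G.outcomeLaw π) ≤ 1 := fun ξ => by
    refine (integral_mono_of_nonneg (ae_of_all _ fun _ => selProb_nonneg _ _ _)
      (integrable_const (1 : ℝ)) (ae_of_all _ fun _ => selProb_le_one _ _ _)).trans ?_
    simp
  refine (integral_mono_of_nonneg (ae_of_all _ fun _ => integral_nonneg fun _ =>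
    selProb_nonneg _ _ _) (integrable_const (1 : ℝ)) (ae_of_all _ h)).trans ?_
  simp

/-- Redrawing agent `i` and applying Fubini reduces her payoff to an integral over her own scheme.
The weight `G.interim π i` is the same for every deviation, because it overwrites her own
observation; so her best-response problem is linear in `π'`. -/
lemma integral_selProb_mul_update (π' : Measure (ℝ × ℝ)) [IsProbabilityMeasure π']
    (φ : ℝ × ℝ → ℝ) (hφm : Measurable φ) (hφ : Integrable φ π') :
    ∫ ω, selProb k ω.observed i * φ (ω i).1 ∂(G.outcomeLaw (Function.update π i π')) =
      ∫ p, G.interim π i p.2 * φ p ∂π' := by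
  have hlaw : G.outcomeLaw (Function.update π i π') =
      ((G.outcomeLaw π).prod (π'.prod (noise G.η))).map
        fun z => Function.update z.1 i z.2 := by
    unfold outcomeLaw
    rw [← pi_update_eq_map]
    congr 1
    ext1 j
    by_cases h : j = i
    · subst h; simp
    · simp [h]
  have hsm : Measurable fun z : Outcome N × ((ℝ × ℝ) × ℝ) =>
      selProb k (Function.update z.1.observed i (z.2.1.2 * z.2.2)) i :=
    (measurable_selProb_update (k := k) i).comp (g := fun z : Outcome N × (ℝ × ℝ) =>
      selProb k (Function.update z.1.observed i (z.2.1 * z.2.2)) i)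
      (f := fun z : Outcome N × ((ℝ × ℝ) × ℝ) => (z.1, (z.2.1.2, z.2.2))) (by fun_prop)
  have hint : Integrable (fun z : Outcome N × ((ℝ × ℝ) × ℝ) =>
      selProb k (Function.update z.1.observed i (z.2.1.2 * z.2.2)) i * φ z.2.1)
      ((G.outcomeLaw π).prod (π'.prod (noise G.η))) := by
    refine Integrable.bdd_mul (c := 1) ((hφ.comp_fst (noise G.η)).comp_snd (G.outcomeLaw π))
      hsm.aestronglyMeasurable (ae_of_all _ fun z => ?_)
    rw [Real.norm_eq_abs, abs_of_nonneg (selProb_nonneg _ _ _)]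
    exact selProb_le_one _ _ _
  rw [hlaw, integral_map measurable_update'.aemeasurable]
  · simp only [Outcome.observed_update, Function.update_self]
    rw [integral_prod_symm _ hint, integral_prod _ hint.integral_prod_right]
    refine integral_congr_ae (ae_of_all _ fun p => ?_)
    simp only [integral_mul_const]
    rfl
  · refine Measurable.aestronglyMeasurable (Measurable.mul ?_ ?_)
    · exact (measurable_selProb k i).comp Outcome.measurable_observed
    · exact hφm.comp (measurable_fst.comp (measurable_pi_apply i))

lemma integral_selProb_mul (φ : ℝ × ℝ → ℝ) (hφm : Measurable φ) (hφ : Integrable φ (π i)) :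
    ∫ ω, selProb k ω.observed i * φ (ω i).1 ∂(G.outcomeLaw π) =
      ∫ p, G.interim π i p.2 * φ p ∂(π i) := by
  have := G.integral_selProb_mul_update π i (π i) φ hφm hφ
  rwa [Function.update_eq_self] at this

end

end Game

/-! ### Extension from `[lo, 1]` to the line, and the martingale property of schemes. -/

/-- The retraction of the real line onto `[lo, 1]`. -/
def clamp (lo x : ℝ) : ℝ := max lo (min x 1)

lemma continuous_clamp (lo : ℝ) : Continuous (clamp lo) := by
  unfold clamp
  fun_prop

lemma monotone_clamp (lo : ℝ) : Monotone (clamp lo) := by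
  intro x y h
  unfold clamp
  gcongr

lemma clamp_mem {lo : ℝ} (h : lo ≤ 1) (x : ℝ) : clamp lo x ∈ Set.Icc lo 1 :=
  ⟨le_max_left _ _, max_le h (min_le_right _ _)⟩

lemma clamp_of_mem {lo x : ℝ} (h : x ∈ Set.Icc lo 1) : clamp lo x = x := by
  rw [clamp, min_eq_left h.2, max_eq_right h.1]

lemma continuous_comp_clamp {lo : ℝ} (hlo : lo ≤ 1) {h : ℝ → ℝ}
    (hh : ContinuousOn h (Set.Icc lo 1)) : Continuous fun x => h (clamp lo x) :=
  hh.comp_continuous (continuous_clamp lo) (clamp_mem hlo)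

lemma exists_bound_comp_clamp {lo : ℝ} (hlo : lo ≤ 1) {h : ℝ → ℝ}
    (hh : ContinuousOn h (Set.Icc lo 1)) : ∃ C, ∀ x, |h (clamp lo x)| ≤ C := by
  obtain ⟨C, hC⟩ := isCompact_Icc.exists_bound_of_continuousOn hh
  exact ⟨C, fun x => hC _ (clamp_mem hlo x)⟩

namespace IsSignalingScheme

variable {lo : ℝ} {F : Measure ℝ} {π : Measure (ℝ × ℝ)}

lemma lo_le_one (h : IsSignalingScheme lo F π) : lo ≤ 1 := by
  have := h.prob
  obtain ⟨p, hp⟩ := h.supp.exists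
  exact hp.1.1.trans hp.1.2

lemma map_fst (h : IsSignalingScheme lo F π) : π.map Prod.fst = F := by
  ext A hA
  rw [Measure.map_apply measurable_fst hA, h.marginal A hA]

lemma integrable (h : IsSignalingScheme lo F π) {f : ℝ × ℝ → ℝ} (hf : Measurable f) (C : ℝ)
    (hC : ∀ p : ℝ × ℝ, p.1 ∈ Set.Icc lo 1 → p.2 ∈ Set.Icc lo 1 → |f p| ≤ C) :
    Integrable f π := by
  have := h.prob
  refine Integrable.of_bound hf.aestronglyMeasurable C ?_
  filter_upwards [h.supp] with p hp
  exact hC p hp.1 hp.2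

lemma integrable_fst (h : IsSignalingScheme lo F π) (hlo : 0 < lo) :
    Integrable (fun p => p.1) π :=
  h.integrable measurable_fst 1 fun p hp _ => by
    rw [abs_of_nonneg (hlo.le.trans hp.1)]; exact hp.2

lemma integrable_snd (h : IsSignalingScheme lo F π) (hlo : 0 < lo) :
    Integrable (fun p => p.2) π :=
  h.integrable measurable_snd 1 fun p _ hp => by
    rw [abs_of_nonneg (hlo.le.trans hp.1)]; exact hp.2

/-- The martingale property tested against bounded measurable functions of the message. -/
lemma posterior_measurable (h : IsSignalingScheme lo F π) (hlo : 0 < lo) {f : ℝ → ℝ}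
    (hf : Measurable f) {C : ℝ} (hC : ∀ x, |f x| ≤ C) :
    ∫ p, (p.1 - p.2) * f p.2 ∂π = 0 := by
  have := h.prob
  -- Weight `π` by the value or by the message and project to the message axis. Both results are
  -- finite measures, and the posterior condition makes their integrals of bounded continuous
  -- functions agree, so the measures coincide.
  have key : ∀ (X : ℝ × ℝ → ℝ), Measurable X → (∀ᵐ p ∂π, X p ∈ Set.Icc lo 1) →
      IsFiniteMeasure ((π.withDensity fun p => ((X p).toNNReal : ENNReal)).map Prod.snd) ∧
      ∀ q : ℝ → ℝ, Measurable q →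
        ∫ x, q x ∂((π.withDensity fun p => ((X p).toNNReal : ENNReal)).map Prod.snd) =
          ∫ p, X p * q p.2 ∂π := by
    intro X hX hXm
    constructor
    · have : IsFiniteMeasure (π.withDensity fun p => ((X p).toNNReal : ENNReal)) := by
        refine isFiniteMeasure_withDensity (ne_of_lt ?_)
        calc ∫⁻ p, ((X p).toNNReal : ENNReal) ∂π ≤ ∫⁻ _, 1 ∂π := by
              refine lintegral_mono_ae ?_
              filter_upwards [hXm] with p hp
              have : (X p).toNNReal ≤ 1 := by simpa using hp.2
              exact_mod_cast this
          _ < ⊤ := by simp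
      infer_instance
    · intro q hq
      rw [integral_map measurable_snd.aemeasurable hq.aestronglyMeasurable,
        integral_withDensity_eq_integral_smul hX.real_toNNReal]
      refine integral_congr_ae ?_
      filter_upwards [hXm] with p hp
      rw [NNReal.smul_def, Real.coe_toNNReal _ (hlo.le.trans hp.1), smul_eq_mul]
  obtain ⟨fin1, e1⟩ := key Prod.fst measurable_fst (h.supp.mono fun p hp => hp.1)
  obtain ⟨fin2, e2⟩ := key Prod.snd measurable_snd (h.supp.mono fun p hp => hp.2)
  have hsub : ∀ q : ℝ → ℝ, Measurable q → (∃ C, ∀ x, |q x| ≤ C) →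
      ∫ p, (p.1 - p.2) * q p.2 ∂π = ∫ p, p.1 * q p.2 ∂π - ∫ p, p.2 * q p.2 ∂π := by
    rintro q hq ⟨D, hD⟩
    rw [← integral_sub]
    · refine integral_congr_ae (ae_of_all _ fun p => ?_)
      ring
    · exact (h.integrable_fst hlo).mul_bdd (c := D) (hq.comp measurable_snd).aestronglyMeasurable
        (ae_of_all _ fun p => hD _)
    · exact (h.integrable_snd hlo).mul_bdd (c := D) (hq.comp measurable_snd).aestronglyMeasurable
        (ae_of_all _ fun p => hD _)
  have heq := ext_of_forall_integral_eq_of_IsFiniteMeasure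
    (μ := (π.withDensity fun p => ((p.1).toNNReal : ENNReal)).map Prod.snd)
    (ν := (π.withDensity fun p => ((p.2).toNNReal : ENNReal)).map Prod.snd) (fun q => by
      rw [e1 q q.continuous.measurable, e2 q q.continuous.measurable, ← sub_eq_zero,
        ← hsub q q.continuous.measurable ⟨‖q‖, fun x => q.norm_coe_le_norm x⟩]
      exact h.posterior q q.continuous.continuousOn)
  rw [hsub f hf ⟨C, hC⟩, ← e1 f hf, ← e2 f hf, heq, sub_self]

lemma setIntegral_fst_eq (h : IsSignalingScheme lo F π) (hlo : 0 < lo) {B : Set ℝ}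
    (hB : MeasurableSet B) :
    ∫ p in Prod.snd ⁻¹' B, p.1 ∂π = ∫ p in Prod.snd ⁻¹' B, p.2 ∂π := by
  rw [← sub_eq_zero, ← integral_sub (h.integrable_fst hlo).integrableOn
    (h.integrable_snd hlo).integrableOn, ← integral_indicator (measurable_snd hB)]
  rw [← h.posterior_measurable hlo (f := B.indicator 1) (measurable_one.indicator hB) (C := 1)]
  · refine integral_congr_ae (ae_of_all _ fun p => ?_)
    by_cases hp : p.2 ∈ B <;> simp [hp]
  · intro x
    by_cases hx : x ∈ B <;> simp [hx]

end IsSignalingScheme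

/-! ### Randomized replacement of messages. -/

/-- The scheme which, on top of `π`, replaces the message by `g j` with probability `w j`. -/
noncomputable def remessage {J : Type*} [Fintype J] (π : Measure (ℝ × ℝ))
    (w : J → ℝ × ℝ → NNReal) (g : J → ℝ × ℝ → ℝ) : Measure (ℝ × ℝ) :=
  ∑ j, (π.withDensity fun p => (w j p : ENNReal)).map fun p => (p.1, g j p)

section Remessage

variable {J : Type*} [Fintype J] {lo : ℝ} {F : Measure ℝ} {π : Measure (ℝ × ℝ)}
  {w : J → ℝ × ℝ → NNReal} {g : J → ℝ × ℝ → ℝ}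

lemma remessage_fst_preimage (hw : ∀ j, Measurable (w j)) (hg : ∀ j, Measurable (g j))
    (hw1 : ∀ p, ∑ j, w j p = 1) {A : Set ℝ} (hA : MeasurableSet A) :
    remessage π w g (Prod.fst ⁻¹' A) = π (Prod.fst ⁻¹' A) := by
  have hA' : MeasurableSet (Prod.fst ⁻¹' A : Set (ℝ × ℝ)) := measurable_fst hA
  unfold remessage
  rw [Measure.finsetSum_apply]
  have : ∀ j, (π.withDensity fun p => (w j p : ENNReal)).map (fun p => (p.1, g j p))
      (Prod.fst ⁻¹' A) = ∫⁻ p in Prod.fst ⁻¹' A, (w j p : ENNReal) ∂π := by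
    intro j
    rw [Measure.map_apply (measurable_fst.prodMk (hg j)) hA', withDensity_apply _
      ((measurable_fst.prodMk (hg j)) hA')]
    rfl
  simp only [this]
  rw [← lintegral_finsetSum _ fun j _ => (hw j).coe_nnreal_ennreal]
  have h1 : ∀ p, ∑ j, (w j p : ENNReal) = 1 := fun p => by
    rw [← ENNReal.ofNNReal_finsetSum, hw1 p, ENNReal.coe_one]
  simp [h1]

lemma ae_remessage (hg : ∀ j, Measurable (g j))
    {P : ℝ × ℝ → Prop} (hP : MeasurableSet {p | P p})
    (h : ∀ j, ∀ᵐ p ∂π, P (p.1, g j p)) : ∀ᵐ p ∂(remessage π w g), P p := by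
  rw [ae_iff]
  unfold remessage
  rw [Measure.finsetSum_apply]
  refine Finset.sum_eq_zero fun j _ => ?_
  rw [← ae_iff (p := P), ae_map_iff (measurable_fst.prodMk (hg j)).aemeasurable hP]
  exact (withDensity_absolutelyContinuous π _) (h j)

lemma integral_remessage [IsFiniteMeasure π] (hw : ∀ j, Measurable (w j))
    (hg : ∀ j, Measurable (g j)) (hw1 : ∀ p, ∑ j, w j p = 1) {φ : ℝ × ℝ → ℝ} (hφ : Measurable φ)
    {C : ℝ} (hC : ∀ j, ∀ᵐ p ∂π, |φ (p.1, g j p)| ≤ C) :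
    ∫ p, φ p ∂(remessage π w g) = ∑ j, ∫ p, w j p * φ (p.1, g j p) ∂π := by
  have hwle : ∀ j p, w j p ≤ 1 := fun j p => by
    rw [← hw1 p]
    exact Finset.single_le_sum (f := fun j => w j p) (fun _ _ => zero_le) (Finset.mem_univ j)
  unfold remessage
  rw [integral_finsetSum_measure]
  · refine Finset.sum_congr rfl fun j _ => ?_
    rw [integral_map (measurable_fst.prodMk (hg j)).aemeasurable hφ.aestronglyMeasurable,
      integral_withDensity_eq_integral_smul (hw j)]
    rfl
  · intro j _
    rw [integrable_map_measure hφ.aestronglyMeasurable (measurable_fst.prodMk (hg j)).aemeasurable,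
      integrable_withDensity_iff_integrable_smul (hw j)]
    refine Integrable.of_bound (C := C) ?_ ?_
    · exact ((hw j).smul (hφ.comp (measurable_fst.prodMk (hg j)))).aestronglyMeasurable
    · filter_upwards [hC j] with p hp
      rw [NNReal.smul_def, smul_eq_mul, norm_mul, Real.norm_eq_abs, Real.norm_eq_abs,
        NNReal.abs_eq]
      have h1 : (w j p : ℝ) ≤ 1 := by exact_mod_cast hwle j p
      exact (mul_le_of_le_one_left (abs_nonneg _) h1).trans hp

/-- Weights summing to one leave the value marginal untouched, so only the range of the new messages
and their posterior means need checking. -/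
lemma IsSignalingScheme.remessage (h : IsSignalingScheme lo F π) (hw : ∀ j, Measurable (w j))
    (hg : ∀ j, Measurable (g j)) (hw1 : ∀ p, ∑ j, w j p = 1)
    (hgm : ∀ j, ∀ p : ℝ × ℝ, p.1 ∈ Set.Icc lo 1 → p.2 ∈ Set.Icc lo 1 → g j p ∈ Set.Icc lo 1)
    (hpost : ∀ (q : ℝ → ℝ) (C : ℝ), Measurable q → (∀ x, |q x| ≤ C) →
      ∑ j, ∫ p, w j p * ((p.1 - g j p) * q (g j p)) ∂π = 0) :
    IsSignalingScheme lo F (remessage π w g) := by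
  have := h.prob
  have hsupp : ∀ᵐ p ∂(NoisyPersuasion.remessage π w g),
      p.1 ∈ Set.Icc lo 1 ∧ p.2 ∈ Set.Icc lo 1 := by
    refine ae_remessage hg ?_ fun j => ?_
    · exact (measurable_fst measurableSet_Icc).inter (measurable_snd measurableSet_Icc)
    · filter_upwards [h.supp] with p hp
      exact ⟨hp.1, hgm j p hp.1 hp.2⟩
  have hmarg : ∀ A : Set ℝ, MeasurableSet A →
      NoisyPersuasion.remessage π w g (Prod.fst ⁻¹' A) = F A := fun A hA => by
    rw [remessage_fst_preimage hw hg hw1 hA, h.marginal A hA]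
  refine ⟨⟨?_⟩, hsupp, hmarg, fun q hq => ?_⟩
  · have h1 := hmarg Set.univ MeasurableSet.univ
    have h2 := h.marginal Set.univ MeasurableSet.univ
    rw [Set.preimage_univ] at h1 h2
    rw [h1, ← h2, measure_univ]
  · obtain ⟨C, hC⟩ := exists_bound_comp_clamp h.lo_le_one hq
    have hqm := (continuous_comp_clamp h.lo_le_one hq).measurable
    rw [← hpost _ C hqm hC, integral_congr_ae (g := fun p : ℝ × ℝ =>
      (p.1 - p.2) * q (clamp lo p.2)), integral_remessage hw hg hw1 (C := (1 - lo) * C)]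
    · exact (measurable_fst.sub measurable_snd).mul (hqm.comp measurable_snd)
    · intro j
      filter_upwards [h.supp] with p hp
      have h3 := hgm j p hp.1 hp.2
      rw [abs_mul]
      refine mul_le_mul ?_ (hC _) (abs_nonneg _) (sub_nonneg.mpr h.lo_le_one)
      rw [abs_le]
      constructor <;> linarith [hp.1.1, hp.1.2, h3.1, h3.2]
    · filter_upwards [hsupp] with p hp
      rw [clamp_of_mem hp.2]

end Remessage

/-! ### What optimality of one agent's scheme implies about her values. -/

section BestResponse

variable {lo : ℝ} {F : Measure ℝ} {π : Measure (ℝ × ℝ)} {g u : ℝ → ℝ} {T : ℝ}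

/-- On a set `B` of messages below `T`, re-messaging all values above `T`, pooled with just enough
of the other values to make the posterior mean `T`, is a feasible deviation; if it does not pay and
`T` is selected with probability at least `1/2`, then messages in `B` must be selected often. -/
lemma integral_excess_le_of_level (h : IsSignalingScheme lo F π) (hlo : 0 < lo)
    (hgm : Measurable g) (hg0 : ∀ m, 0 ≤ g m) (hg1 : ∀ m, g m ≤ 1)
    (hu : Continuous u) (humono : Monotone u) (hupos : ∀ v, 0 < u v)
    (hT : T ∈ Set.Icc lo 1) (hgT : 1 / 2 ≤ g T)
    (hopt : ∀ π', IsSignalingScheme lo F π' →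
      ∫ p, g p.2 * u p.1 ∂π' ≤ ∫ p, g p.2 * u p.1 ∂π)
    {B : Set ℝ} (hB : MeasurableSet B) (hBT : ∀ m ∈ B, m < T) {γ : ℝ} (hγ : ∀ m ∈ B, g m ≤ γ) :
    ∫ p, B.indicator 1 p.2 * max 0 (p.1 - T) ∂π ≤
      2 * T * γ * ∫ p, B.indicator (1 : ℝ → ℝ) p.2 ∂π := by
  classical
  have := h.prob
  have hT0 : 0 < T := hlo.trans_le hT.1
  set I : ℝ × ℝ → ℝ := fun p => B.indicator 1 p.2 with hIdef
  have hIm : Measurable I := (measurable_one.indicator hB).comp measurable_snd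
  have hI01 : ∀ p, I p = 0 ∨ I p = 1 := fun p => by
    by_cases hp : p.2 ∈ B <;> simp [hIdef, hp]
  have hI0 : ∀ p, 0 ≤ I p := fun p => by rcases hI01 p with h | h <;> simp [h]
  have hI1 : ∀ p, I p ≤ 1 := fun p => by rcases hI01 p with h | h <;> simp [h]
  have hIi : ∀ {f : ℝ × ℝ → ℝ}, Integrable f π → Integrable (fun p => I p * f p) π := fun hf =>
    hf.bdd_mul (c := 1) hIm.aestronglyMeasurable (ae_of_all _ fun p => by
      rw [Real.norm_eq_abs, abs_of_nonneg (hI0 p)]; exact hI1 p)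
  have hfst := h.integrable_fst hlo
  have hsnd := h.integrable_snd hlo
  have hImean : ∫ p, I p * p.1 ∂π = ∫ p, I p * p.2 ∂π := by
    have := h.setIntegral_fst_eq hlo hB
    rw [← integral_indicator (measurable_snd hB), ← integral_indicator (measurable_snd hB)] at this
    refine Eq.trans (integral_congr_ae (ae_of_all _ fun p => ?_))
      (this.trans (integral_congr_ae (ae_of_all _ fun p => ?_))) <;>
    by_cases hp : p.2 ∈ B <;> simp [hIdef, hp]
  have hpi : Integrable (fun p : ℝ × ℝ => max 0 (p.1 - T)) π :=
    h.integrable (by fun_prop) 1 fun p hp _ => by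
      rw [abs_of_nonneg (le_max_left _ _)]
      exact max_le zero_le_one (by linarith [hp.2])
  have hmi : Integrable (fun p : ℝ × ℝ => max 0 (T - p.1)) π :=
    h.integrable (by fun_prop) 1 fun p hp _ => by
      rw [abs_of_nonneg (le_max_left _ _)]
      exact max_le zero_le_one (by linarith [hp.1, hT.2])
  set num := ∫ p, I p * max 0 (p.1 - T) ∂π with hnum
  set den := ∫ p, I p * max 0 (T - p.1) ∂π with hden
  have hnum0 : 0 ≤ num := integral_nonneg fun p => mul_nonneg (hI0 p) (le_max_left _ _)
  have hden0 : 0 ≤ den := integral_nonneg fun p => mul_nonneg (hI0 p) (le_max_left _ _)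
  -- On `B` the mean value equals the mean message, which is below `T`, so the shortfall below `T`
  -- outweighs the excess and can balance it.
  have hle : num ≤ den := by
    have e1 : num - den = ∫ p, I p * p.1 ∂π - ∫ p, I p * T ∂π := by
      rw [hnum, hden, ← integral_sub (hIi hpi) (hIi hmi),
        ← integral_sub (hIi hfst) (hIi (integrable_const T))]
      refine integral_congr_ae (ae_of_all _ fun p => ?_)
      rcases le_total p.1 T with hp | hp
      · simp only [max_eq_left (sub_nonpos.mpr hp), max_eq_right (sub_nonneg.mpr hp)]; ring
      · simp only [max_eq_left (sub_nonpos.mpr hp), max_eq_right (sub_nonneg.mpr hp)]; ring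
    have e2 : ∫ p, I p * p.2 ∂π ≤ ∫ p, I p * T ∂π := by
      refine integral_mono (hIi hsnd) (hIi (integrable_const T)) fun p => ?_
      by_cases hp : p.2 ∈ B
      · simpa [hIdef, hp] using (hBT _ hp).le
      · simp [hIdef, hp]
    linarith
  -- The share of values at most `T` that brings the pool's mean to `T`. If `den = 0` then `num = 0`
  -- too, and the default value `0` is the right one.
  set lam := num / den with hlam
  have hlam0 : 0 ≤ lam := div_nonneg hnum0 hden0
  have hlam1 : lam ≤ 1 := div_le_one_of_le₀ hle hden0
  have hlamden : lam * den = num := by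
    rcases hden0.eq_or_lt with h0 | h0
    · rw [← h0, mul_zero]; linarith
    · exact div_mul_cancel₀ _ h0.ne'
  set w : ℝ × ℝ → ℝ := fun p => I p * if T < p.1 then 1 else lam with hwdef
  have hifm : Measurable fun p : ℝ × ℝ => if T < p.1 then (1 : ℝ) else lam :=
    Measurable.ite (measurableSet_lt measurable_const measurable_fst) measurable_const
      measurable_const
  have hwm : Measurable w := hIm.mul hifm
  have hif0 : ∀ p : ℝ × ℝ, 0 ≤ (if T < p.1 then (1 : ℝ) else lam) := fun p => by
    split_ifs; exacts [zero_le_one, hlam0]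
  have hif1 : ∀ p : ℝ × ℝ, (if T < p.1 then (1 : ℝ) else lam) ≤ 1 := fun p => by
    split_ifs; exacts [le_rfl, hlam1]
  have hifl : ∀ p : ℝ × ℝ, lam ≤ (if T < p.1 then (1 : ℝ) else lam) := fun p => by
    split_ifs; exacts [hlam1, le_rfl]
  have hw0 : ∀ p, 0 ≤ w p := fun p => mul_nonneg (hI0 p) (hif0 p)
  have hwI : ∀ p, w p ≤ I p := fun p => mul_le_of_le_one_right (hI0 p) (hif1 p)
  have hwi : ∀ {f : ℝ × ℝ → ℝ}, Integrable f π → Integrable (fun p => w p * f p) π := fun hf =>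
    hf.bdd_mul (c := 1) hwm.aestronglyMeasurable (ae_of_all _ fun p => by
      rw [Real.norm_eq_abs, abs_of_nonneg (hw0 p)]; exact (hwI p).trans (hI1 p))
  have hwint : Integrable w π := by simpa using hwi (integrable_const (1 : ℝ))
  have hIint : Integrable I π := by simpa using hIi (integrable_const (1 : ℝ))
  have hwmean : ∫ p, w p * (p.1 - T) ∂π = 0 := by
    have : ∫ p, w p * (p.1 - T) ∂π = num - lam * den := by
      rw [hnum, hden, ← integral_const_mul, ← integral_sub (hIi hpi) ((hIi hmi).const_mul _)]
      refine integral_congr_ae (ae_of_all _ fun p => ?_)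
      simp only [hwdef]
      split_ifs with hp
      · rw [max_eq_right (by linarith), max_eq_left (by linarith)]; ring
      · rw [max_eq_left (by linarith), max_eq_right (by linarith)]; ring
    rw [this, hlamden, sub_self]
  -- the deviation
  set W : Bool → ℝ × ℝ → NNReal := fun j p =>
    if j then (w p).toNNReal else (1 - w p).toNNReal with hWdef
  set M : Bool → ℝ × ℝ → ℝ := fun j p => if j then T else if p.2 ∈ B then p.1 else p.2 with hMdef
  have hWm : ∀ j, Measurable (W j) := by
    rintro (_ | _)
    · exact (measurable_const.sub hwm).real_toNNReal
    · exact hwm.real_toNNReal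
  have hMm : ∀ j, Measurable (M j) := by
    rintro (_ | _)
    · change Measurable fun p : ℝ × ℝ => if p.2 ∈ B then p.1 else p.2
      exact Measurable.ite (measurable_snd hB) measurable_fst measurable_snd
    · exact measurable_const
  have hWt : ∀ p, (W true p : ℝ) = w p := fun p => Real.coe_toNNReal _ (hw0 p)
  have hWf : ∀ p, (W false p : ℝ) = 1 - w p := fun p =>
    Real.coe_toNNReal _ (sub_nonneg.mpr ((hwI p).trans (hI1 p)))
  have hW1 : ∀ p, ∑ j, W j p = 1 := fun p => by
    rw [Fintype.sum_bool]
    apply NNReal.coe_injective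
    rw [NNReal.coe_add, hWt, hWf, NNReal.coe_one]
    ring
  have hMmem : ∀ j, ∀ p : ℝ × ℝ, p.1 ∈ Set.Icc lo 1 → p.2 ∈ Set.Icc lo 1 →
      M j p ∈ Set.Icc lo 1 := by
    rintro (_ | _) p h1 h2
    · by_cases hp : p.2 ∈ B
      · simpa [hMdef, hp] using h1
      · simpa [hMdef, hp] using h2
    · exact hT
  have hscheme : IsSignalingScheme lo F (remessage π W M) := by
    refine h.remessage hWm hMm hW1 hMmem fun q C hq hC => ?_
    rw [Fintype.sum_bool]
    have e1 : ∫ p, (W true p : ℝ) * ((p.1 - M true p) * q (M true p)) ∂π = 0 := by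
      simp only [hWt]
      have : ∀ p : ℝ × ℝ, w p * ((p.1 - M true p) * q (M true p)) = w p * (p.1 - T) * q T :=
        fun p => by simp only [hMdef, if_true]; ring
      simp only [this]
      rw [integral_mul_const, hwmean, zero_mul]
    have e2 : ∫ p, (W false p : ℝ) * ((p.1 - M false p) * q (M false p)) ∂π = 0 := by
      simp only [hWf]
      -- Unpooled values in `B` are fully revealed and contribute zero; what remains is the original
      -- scheme tested outside `B`.
      rw [← h.posterior_measurable hlo (hq.indicator hB.compl) (C := C)]
      · refine integral_congr_ae (ae_of_all _ fun p => ?_)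
        by_cases hp : p.2 ∈ B <;> simp [hMdef, hwdef, hIdef, hp]
      · intro x
        by_cases hx : x ∈ B
        · simpa [hx] using (abs_nonneg _).trans (hC 0)
        · simpa [hx] using hC x
    rw [e1, e2, add_zero]
  have hu1 : ∀ v ∈ Set.Icc lo 1, |u v| ≤ u 1 := fun v hv => by
    rw [abs_of_pos (hupos v)]; exact humono hv.2
  have hui : Integrable (fun p : ℝ × ℝ => u p.1) π :=
    h.integrable (hu.measurable.comp measurable_fst) (u 1) fun p hp _ => hu1 _ hp
  have hgu : ∀ m v, v ∈ Set.Icc lo 1 → |g m * u v| ≤ u 1 := fun m v hv => by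
    rw [abs_mul, abs_of_nonneg (hg0 m)]
    exact (mul_le_of_le_one_left (abs_nonneg _) (hg1 m)).trans (hu1 v hv)
  have hgui : Integrable (fun p : ℝ × ℝ => g p.2 * u p.1) π :=
    h.integrable ((hgm.comp measurable_snd).mul (hu.measurable.comp measurable_fst)) (u 1)
      fun p hp _ => hgu _ _ hp
  have hdev := hopt _ hscheme
  rw [integral_remessage hWm hMm hW1 (φ := fun p => g p.2 * u p.1)
    ((hgm.comp measurable_snd).mul (hu.measurable.comp measurable_fst)) (C := u 1)
    (fun j => h.supp.mono fun p hp => hgu _ _ hp.1), Fintype.sum_bool] at hdev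
  simp only [hWt, hWf] at hdev
  -- The pool earns at least half its utility; the revealed rest of `B` earns something nonnegative,
  -- which is discarded; outside `B` nothing changes. What is given up is the old payoff on `B`.
  have hgain : 1 / 2 * ∫ p, w p * u p.1 ∂π ≤ γ * ∫ p, I p * u p.1 ∂π := by
    have d1 : 1 / 2 * ∫ p, w p * u p.1 ∂π ≤ ∫ p, w p * (g (M true p) * u p.1) ∂π := by
      rw [← integral_const_mul]
      refine integral_mono ((hwi hui).const_mul _) (hwi (hui.const_mul (g T))) fun p => ?_
      have : 0 ≤ w p * u p.1 := mul_nonneg (hw0 p) (hupos _).le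
      change 1 / 2 * (w p * u p.1) ≤ w p * (g T * u p.1)
      nlinarith
    have d2 : ∫ p, (1 - I p) * (g p.2 * u p.1) ∂π ≤
        ∫ p, (1 - w p) * (g (M false p) * u p.1) ∂π := by
      have hii : Integrable (fun p : ℝ × ℝ => g (M false p) * u p.1) π :=
        h.integrable ((hgm.comp (hMm false)).mul (hu.measurable.comp measurable_fst)) (u 1)
          fun p hp _ => hgu _ _ hp
      refine integral_mono ?_ ?_ fun p => ?_
      · simp only [sub_mul, one_mul]
        exact hgui.sub (hIi hgui)
      · simp only [sub_mul, one_mul]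
        exact hii.sub (hwi hii)
      · by_cases hp : p.2 ∈ B
        · have h1 : I p = 1 := by simp [hIdef, hp]
          change (1 - I p) * (g p.2 * u p.1) ≤ (1 - w p) * (g (M false p) * u p.1)
          rw [h1, sub_self, zero_mul]
          exact mul_nonneg (sub_nonneg.mpr ((hwI p).trans (hI1 p)))
            (mul_nonneg (hg0 _) (hupos _).le)
        · simp [hIdef, hwdef, hMdef, hp]
    have d3 : ∫ p, (1 - I p) * (g p.2 * u p.1) ∂π =
        ∫ p, g p.2 * u p.1 ∂π - ∫ p, I p * (g p.2 * u p.1) ∂π := by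
      rw [← integral_sub hgui (hIi hgui)]
      refine integral_congr_ae (ae_of_all _ fun p => ?_)
      ring
    have d4 : ∫ p, I p * (g p.2 * u p.1) ∂π ≤ γ * ∫ p, I p * u p.1 ∂π := by
      rw [← integral_const_mul]
      refine integral_mono (hIi hgui) ((hIi hui).const_mul _) fun p => ?_
      by_cases hp : p.2 ∈ B
      · simpa [hIdef, hp] using mul_le_mul_of_nonneg_right (hγ _ hp) (hupos p.1).le
      · simp [hIdef, hp]
    linarith
  -- a correlation inequality
  set b := ∫ p, I p ∂π with hb
  set S := ∫ p, w p ∂π with hS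
  have hb0 : 0 ≤ b := integral_nonneg hI0
  have hSb : S ≤ b := integral_mono hwint hIint hwI
  have hlS : lam * b ≤ S := by
    rw [hb, ← integral_const_mul]
    refine integral_mono (hIint.const_mul _) hwint fun p => ?_
    change lam * I p ≤ I p * _
    rw [mul_comm]
    exact mul_le_mul_of_nonneg_left (hifl p) (hI0 p)
  have hcor : S * ∫ p, I p * u p.1 ∂π ≤ b * ∫ p, w p * u p.1 ∂π := by
    -- Chebyshev's inequality: the pooling rate and `u` both increase across `T`. Centring `u` at `u
    -- T` makes the integrand nonnegative, since `lam * b ≤ S ≤ b`, and the two centring terms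
    -- cancel in the integral.
    have hpt : ∀ p : ℝ × ℝ, 0 ≤ b * (w p * u p.1) - S * (I p * u p.1)
        - u T * b * w p + u T * S * I p := fun p => by
      have hfac : b * (w p * u p.1) - S * (I p * u p.1) - u T * b * w p + u T * S * I p =
          I p * ((b * (if T < p.1 then 1 else lam) - S) * (u p.1 - u T)) := by
        simp only [hwdef]; ring
      rw [hfac]
      refine mul_nonneg (hI0 p) ?_
      split_ifs with hp
      · exact mul_nonneg (by linarith) (sub_nonneg.mpr (humono hp.le))
      · exact mul_nonneg_of_nonpos_of_nonpos (by linarith)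
          (sub_nonpos.mpr (humono (not_lt.mp hp)))
    have hint : 0 ≤ ∫ p, (b * (w p * u p.1) - S * (I p * u p.1)
        - u T * b * w p + u T * S * I p) ∂π := integral_nonneg hpt
    have i1 := (hwi hui).const_mul b
    have i2 := (hIi hui).const_mul S
    have i3 := hwint.const_mul (u T * b)
    have i4 := hIint.const_mul (u T * S)
    have i12 : Integrable (fun p : ℝ × ℝ => b * (w p * u p.1) - S * (I p * u p.1)) π := i1.sub i2
    have i123 : Integrable (fun p : ℝ × ℝ => b * (w p * u p.1) - S * (I p * u p.1)
        - u T * b * w p) π := i12.sub i3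
    rw [integral_add i123 i4, integral_sub i12 i3, integral_sub i1 i2,
      integral_const_mul, integral_const_mul, integral_const_mul, integral_const_mul, ← hb,
      ← hS] at hint
    linarith
  have hS2 : S ≤ 2 * γ * b := by
    rcases hb0.eq_or_lt with h0 | h0
    · rw [← h0] at hSb ⊢
      linarith
    · have hIu : 0 < ∫ p, I p * u p.1 ∂π := by
        refine lt_of_lt_of_le (mul_pos (hupos lo) h0) ?_
        rw [hb, ← integral_const_mul]
        refine integral_mono_ae (hIint.const_mul _) (hIi hui) ?_
        filter_upwards [h.supp] with p hp
        rw [mul_comm]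
        exact mul_le_mul_of_nonneg_left (humono hp.1.1) (hI0 p)
      have h5 : b * (1 / 2 * ∫ p, w p * u p.1 ∂π) ≤ b * (γ * ∫ p, I p * u p.1 ∂π) :=
        mul_le_mul_of_nonneg_left hgain hb0
      refine le_of_mul_le_mul_right ?_ hIu
      linarith
  -- The pool has mean value `T` and contains all of the excess.
  have hTS : num ≤ T * S := by
    have e : ∫ p, w p * (p.1 - T) ∂π = ∫ p, w p * p.1 ∂π - T * S := by
      rw [hS, ← integral_const_mul, ← integral_sub (hwi hfst) (hwint.const_mul T)]
      refine integral_congr_ae (ae_of_all _ fun p => ?_)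
      ring
    have e2 : num ≤ ∫ p, w p * p.1 ∂π := by
      refine integral_mono_ae (hIi hpi) (hwi hfst) ?_
      filter_upwards [h.supp] with p hp
      have hp0 : 0 ≤ p.1 := hlo.le.trans hp.1.1
      simp only [hwdef]
      split_ifs with hpT
      · rw [mul_one]
        exact mul_le_mul_of_nonneg_left (max_le hp0 (by linarith)) (hI0 p)
      · rw [max_eq_left (by linarith), mul_zero]
        exact mul_nonneg (mul_nonneg (hI0 p) hlam0) hp0
    linarith
  calc num ≤ T * S := hTS
    _ ≤ T * (2 * γ * b) := mul_le_mul_of_nonneg_left hS2 hT0.le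
    _ = 2 * T * γ * b := by ring

/-- Messages below `T` are selected often enough to account for the values above `T`. -/
lemma integral_excess_below_le (h : IsSignalingScheme lo F π) (hlo : 0 < lo)
    (hgm : Measurable g) (hg0 : ∀ m, 0 ≤ g m) (hg1 : ∀ m, g m ≤ 1)
    (hu : Continuous u) (humono : Monotone u) (hupos : ∀ v, 0 < u v)
    (hT : T ∈ Set.Icc lo 1) (hgT : 1 / 2 ≤ g T)
    (hopt : ∀ π', IsSignalingScheme lo F π' →
      ∫ p, g p.2 * u p.1 ∂π' ≤ ∫ p, g p.2 * u p.1 ∂π) :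
    ∫ p, (Set.Iio T).indicator 1 p.2 * max 0 (p.1 - T) ∂π ≤
      2 * T * ∫ p, (Set.Iio T).indicator (1 : ℝ → ℝ) p.2 * g p.2 ∂π := by
  classical
  have := h.prob
  have hT0 : 0 < T := hlo.trans_le hT.1
  have hIi : ∀ {B : Set ℝ}, MeasurableSet B → ∀ {f : ℝ × ℝ → ℝ}, Integrable f π →
      Integrable (fun p => B.indicator (1 : ℝ → ℝ) p.2 * f p) π := fun {B} hB f hf =>
    hf.bdd_mul (c := 1) ((measurable_one.indicator hB).comp measurable_snd).aestronglyMeasurable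
      (ae_of_all _ fun p => by by_cases hp : p.2 ∈ B <;> simp [hp])
  have hpi : Integrable (fun p : ℝ × ℝ => max 0 (p.1 - T)) π :=
    h.integrable (by fun_prop) 1 fun p hp _ => by
      rw [abs_of_nonneg (le_max_left _ _)]
      exact max_le zero_le_one (by linarith [hp.2])
  have hgi : Integrable (fun p : ℝ × ℝ => g p.2) π :=
    h.integrable (hgm.comp measurable_snd) 1 fun p _ _ => by
      rw [abs_of_nonneg (hg0 _)]; exact hg1 _
  have hmain : ∀ n : ℕ, 0 < n → ∫ p, (Set.Iio T).indicator 1 p.2 * max 0 (p.1 - T) ∂π ≤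
      2 * T * ∫ p, (Set.Iio T).indicator (1 : ℝ → ℝ) p.2 * g p.2 ∂π + 2 * T * (1 / n) := by
    intro n hn
    have hn' : (0 : ℝ) < n := by exact_mod_cast hn
    -- Slices on which `g` varies by at most `1 / n`, so the bound `γ = (j + 1) / n` exceeds `g` by
    -- at most `1 / n`; the total error `2 T / n` vanishes as `n` grows.
    set B : ℕ → Set ℝ := fun j => Set.Iio T ∩ {m | ⌊(n : ℝ) * g m⌋₊ = j} with hBdef
    have hBm : ∀ j, MeasurableSet (B j) := fun j => by
      refine measurableSet_Iio.inter ?_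
      exact (Nat.measurable_floor.comp (measurable_const.mul hgm)) (measurableSet_singleton j)
    have hsum : ∀ m, ∑ j ∈ Finset.range (n + 1), (B j).indicator (1 : ℝ → ℝ) m =
        (Set.Iio T).indicator 1 m := by
      intro m
      by_cases hm : m < T
      · have hfl : ⌊(n : ℝ) * g m⌋₊ < n + 1 := by
          rw [Nat.lt_succ_iff]
          refine Nat.floor_le_of_le ?_
          exact mul_le_of_le_one_right hn'.le (hg1 m)
        rw [Finset.sum_eq_single_of_mem _ (Finset.mem_range.mpr hfl)]
        · simp [hBdef, hm]
        · intro j _ hj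
          simp [hBdef, hj.symm]
      · simp [hBdef, hm]
    have hlevel : ∀ j, ∫ p, (B j).indicator 1 p.2 * max 0 (p.1 - T) ∂π ≤
        2 * T * ∫ p, (B j).indicator (1 : ℝ → ℝ) p.2 * (g p.2 + 1 / n) ∂π := by
      intro j
      have hlev : ∀ m ∈ B j, g m ≤ (j + 1) / n ∧ (j : ℝ) / n ≤ g m := by
        rintro m ⟨-, hm⟩
        have hm' : ⌊(n : ℝ) * g m⌋₊ = j := hm
        rw [le_div_iff₀ hn', div_le_iff₀ hn', ← hm', mul_comm (g m)]
        exact ⟨(Nat.lt_floor_add_one _).le, Nat.floor_le (mul_nonneg hn'.le (hg0 m))⟩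
      refine (integral_excess_le_of_level h hlo hgm hg0 hg1 hu humono hupos hT hgT hopt (hBm j)
        (fun m hm => hm.1) fun m hm => (hlev m hm).1).trans ?_
      rw [mul_assoc, ← integral_const_mul]
      refine mul_le_mul_of_nonneg_left ?_ (by positivity)
      have hone := hIi (hBm j) (integrable_const (1 : ℝ))
      simp only [mul_one] at hone
      refine integral_mono (hone.const_mul _)
        (hIi (hBm j) (hgi.add (integrable_const _))) fun p => ?_
      by_cases hp : p.2 ∈ B j
      · have := (hlev _ hp).2
        simp only [hp, Set.indicator_of_mem, Pi.one_apply, mul_one, one_mul]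
        rw [add_div]
        simpa using this
      · simp [hp]
    have hsplit : ∀ f : ℝ × ℝ → ℝ, Integrable f π →
        ∫ p, (Set.Iio T).indicator (1 : ℝ → ℝ) p.2 * f p ∂π =
          ∑ j ∈ Finset.range (n + 1), ∫ p, (B j).indicator (1 : ℝ → ℝ) p.2 * f p ∂π := by
      intro f hf
      rw [← integral_finsetSum _ fun j _ => hIi (hBm j) hf]
      refine integral_congr_ae (ae_of_all _ fun p => ?_)
      simp only
      rw [← hsum, Finset.sum_mul]
    have hgi' : Integrable (fun p : ℝ × ℝ => g p.2 + 1 / (n : ℝ)) π :=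
      hgi.add (integrable_const _)
    have htotal : ∫ p, (Set.Iio T).indicator 1 p.2 * max 0 (p.1 - T) ∂π ≤
        2 * T * ∫ p, (Set.Iio T).indicator (1 : ℝ → ℝ) p.2 * (g p.2 + 1 / n) ∂π := by
      rw [hsplit _ hpi, hsplit _ hgi', Finset.mul_sum]
      exact Finset.sum_le_sum fun j _ => hlevel j
    refine htotal.trans ?_
    rw [← mul_add]
    refine mul_le_mul_of_nonneg_left ?_ (by positivity)
    simp only [mul_add]
    rw [integral_add (hIi measurableSet_Iio hgi) (hIi measurableSet_Iio (integrable_const _))]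
    refine add_le_add le_rfl ?_
    refine (integral_mono (hIi measurableSet_Iio (integrable_const _))
      (integrable_const (1 / (n : ℝ))) fun p => ?_).trans (by simp)
    by_cases hp : p.2 < T <;> simp [hp]
  refine le_of_forall_pos_le_add fun ε hε => ?_
  obtain ⟨n, hn⟩ := exists_nat_gt (2 * T / ε)
  have hn0 : (0 : ℝ) < n := lt_trans (by positivity) hn
  refine (hmain n (by exact_mod_cast hn0)).trans (add_le_add le_rfl ?_)
  rw [mul_one_div, div_le_iff₀ hn0]
  rw [div_lt_iff₀ hε] at hn
  linarith

/-- The expected excess of an agent's value over `T` when her scheme is a best response and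
messages from `T` on are selected with probability at least `1/2`. -/
lemma integral_excess_le (h : IsSignalingScheme lo F π) (hlo : 0 < lo)
    (hgm : Measurable g) (hg0 : ∀ m, 0 ≤ g m) (hg1 : ∀ m, g m ≤ 1)
    (hu : Continuous u) (humono : Monotone u) (hupos : ∀ v, 0 < u v)
    (hT : 0 < T) (hgT : ∀ m, T ≤ m → 1 / 2 ≤ g m)
    (hopt : ∀ π', IsSignalingScheme lo F π' →
      ∫ p, g p.2 * u p.1 ∂π' ≤ ∫ p, g p.2 * u p.1 ∂π) :
    ∫ p, max 0 (p.1 - T) ∂π ≤ 2 * ∫ p, g p.2 * p.2 ∂π + 2 * T * ∫ p, g p.2 ∂π := by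
  have := h.prob
  have hIi : ∀ {B : Set ℝ}, MeasurableSet B → ∀ {f : ℝ × ℝ → ℝ}, Integrable f π →
      Integrable (fun p => B.indicator (1 : ℝ → ℝ) p.2 * f p) π := fun {B} hB f hf =>
    hf.bdd_mul (c := 1) ((measurable_one.indicator hB).comp measurable_snd).aestronglyMeasurable
      (ae_of_all _ fun p => by by_cases hp : p.2 ∈ B <;> simp [hp])
  have hfst := h.integrable_fst hlo
  have hsnd := h.integrable_snd hlo
  have hpi : Integrable (fun p : ℝ × ℝ => max 0 (p.1 - T)) π :=
    h.integrable (by fun_prop) 1 fun p hp _ => by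
      rw [abs_of_nonneg (le_max_left _ _)]
      exact max_le zero_le_one (by linarith [hp.2])
  have hgi : Integrable (fun p : ℝ × ℝ => g p.2) π :=
    h.integrable (hgm.comp measurable_snd) 1 fun p _ _ => by
      rw [abs_of_nonneg (hg0 _)]; exact hg1 _
  have hgsnd : Integrable (fun p : ℝ × ℝ => g p.2 * p.2) π :=
    hsnd.bdd_mul (c := 1) (hgm.comp measurable_snd).aestronglyMeasurable
      (ae_of_all _ fun p => by rw [Real.norm_eq_abs, abs_of_nonneg (hg0 _)]; exact hg1 _)
  have hgint0 : 0 ≤ ∫ p, g p.2 ∂π := integral_nonneg fun p => hg0 _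
  have hsplit : ∫ p, max 0 (p.1 - T) ∂π =
      ∫ p, (Set.Iio T).indicator 1 p.2 * max 0 (p.1 - T) ∂π +
        ∫ p, (Set.Ici T).indicator 1 p.2 * max 0 (p.1 - T) ∂π := by
    rw [← integral_add (hIi measurableSet_Iio hpi) (hIi measurableSet_Ici hpi)]
    refine integral_congr_ae (ae_of_all _ fun p => ?_)
    rcases lt_or_ge p.2 T with hp | hp
    · simp [hp, not_le.mpr hp]
    · simp [hp, not_lt.mpr hp]
  have habove : ∫ p, (Set.Ici T).indicator 1 p.2 * max 0 (p.1 - T) ∂π ≤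
      2 * ∫ p, g p.2 * p.2 ∂π := by
    have hmean := h.setIntegral_fst_eq hlo (measurableSet_Ici (a := T))
    rw [← integral_indicator (measurable_snd measurableSet_Ici),
      ← integral_indicator (measurable_snd measurableSet_Ici)] at hmean
    calc ∫ p, (Set.Ici T).indicator 1 p.2 * max 0 (p.1 - T) ∂π
        ≤ ∫ p, (Prod.snd ⁻¹' Set.Ici T).indicator (fun p : ℝ × ℝ => p.1) p ∂π := by
          refine integral_mono_ae (hIi measurableSet_Ici hpi)
            (hfst.indicator (measurable_snd measurableSet_Ici)) ?_
          filter_upwards [h.supp] with p hp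
          by_cases hpT : T ≤ p.2
          · simpa [hpT] using ⟨hlo.le.trans hp.1.1, hT.le⟩
          · simp [hpT]
      _ = ∫ p, (Prod.snd ⁻¹' Set.Ici T).indicator (fun p : ℝ × ℝ => p.2) p ∂π := hmean
      _ ≤ ∫ p, 2 * (g p.2 * p.2) ∂π := by
          refine integral_mono_ae (hsnd.indicator (measurable_snd measurableSet_Ici))
            (hgsnd.const_mul 2) ?_
          filter_upwards [h.supp] with p hp
          have hp0 : 0 ≤ p.2 := hlo.le.trans hp.2.1
          by_cases hpT : T ≤ p.2
          · have := mul_le_mul_of_nonneg_right (hgT _ hpT) hp0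
            simp only [Set.mem_preimage, Set.mem_Ici, hpT, Set.indicator_of_mem]
            linarith
          · have := mul_nonneg (hg0 p.2) hp0
            simpa [hpT] using this
      _ = 2 * ∫ p, g p.2 * p.2 ∂π := integral_const_mul _ _
  have hbelow : ∫ p, (Set.Iio T).indicator 1 p.2 * max 0 (p.1 - T) ∂π ≤
      2 * T * ∫ p, g p.2 ∂π := by
    have hnn : 0 ≤ 2 * T * ∫ p, g p.2 ∂π := by positivity
    -- The deviation needs `T` as an admissible message. Otherwise the left side is zero: no value
    -- exceeds `T > 1`, and no message lies below `T < lo`.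
    rcases lt_or_ge 1 T with h1 | h1
    · refine le_trans (le_of_eq ?_) hnn
      rw [integral_eq_zero_of_ae]
      filter_upwards [h.supp] with p hp
      rw [max_eq_left (by linarith [hp.1.2]), mul_zero, Pi.zero_apply]
    rcases lt_or_ge T lo with h2 | h2
    · refine le_trans (le_of_eq ?_) hnn
      rw [integral_eq_zero_of_ae]
      filter_upwards [h.supp] with p hp
      have : ¬ p.2 < T := not_lt.mpr (h2.le.trans hp.2.1)
      simp [this]
    refine (integral_excess_below_le h hlo hgm hg0 hg1 hu humono hupos ⟨h2, h1⟩ (hgT T le_rfl)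
      hopt).trans (mul_le_mul_of_nonneg_left ?_ (by positivity))
    refine integral_mono (hIi measurableSet_Iio hgi) hgi fun p => ?_
    by_cases hp : p.2 < T
    · simp [hp]
    · simpa [hp] using hg0 _
  linarith

end BestResponse
-- Equilibrium welfare against the first best.
namespace Game

variable {N k : ℕ} {G : Game N k} {π : Fin N → Measure (ℝ × ℝ)}

lemma IsProfile.ae_outcome (hπ : G.IsProfile π) : ∀ᵐ ω ∂(G.outcomeLaw π), ∀ i,
    (ω.value i ∈ Set.Icc G.lo 1 ∧ ω.message i ∈ Set.Icc G.lo 1) ∧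
      (ω i).2 ∈ Set.Icc (1 - G.η) (1 + G.η) := by
  have hprob : ∀ i, IsProbabilityMeasure (π i) := fun i => (hπ i).prob
  rw [ae_all_iff]
  intro i
  have h1 : ∀ᵐ x ∂((π i).prod (noise G.η)), (x.1.1 ∈ Set.Icc G.lo 1 ∧ x.1.2 ∈ Set.Icc G.lo 1) ∧
      x.2 ∈ Set.Icc (1 - G.η) (1 + G.η) := by
    have h2 := Measure.quasiMeasurePreserving_fst (μ := π i) (ν := noise G.η) |>.ae (hπ i).supp
    have h3 := Measure.quasiMeasurePreserving_snd (μ := π i) (ν := noise G.η) |>.ae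
      (ae_noise_mem G.η)
    filter_upwards [h2, h3] with x hx hx'
    exact ⟨hx, hx'⟩
  exact (Measure.tendsto_eval_ae_ae (μ := fun i => (π i).prod (noise G.η)) (i := i)).eventually h1

lemma IsProfile.update (hπ : G.IsProfile π) {i : Fin N} {π' : Measure (ℝ × ℝ)}
    (h : IsSignalingScheme G.lo (G.prior i) π') : G.IsProfile (Function.update π i π') := by
  intro j
  by_cases hj : j = i
  · subst hj; simpa
  · simpa [hj] using hπ j

lemma integrable_selProb_mul_message (hπ : G.IsProfile π) (i : Fin N) :
    Integrable (fun ω : Outcome N => selProb k ω.observed i * ω.message i) (G.outcomeLaw π) := by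
  have hprob : ∀ i, IsProbabilityMeasure (π i) := fun i => (hπ i).prob
  refine Integrable.of_bound (C := 1) (Measurable.aestronglyMeasurable (Measurable.mul
    ((measurable_selProb k i).comp Outcome.measurable_observed) ?_)) ?_
  · unfold Outcome.message
    fun_prop
  · filter_upwards [hπ.ae_outcome] with ω hω
    have h0 : 0 ≤ ω.message i := G.lo_pos.le.trans (hω i).1.2.1
    rw [Real.norm_eq_abs, abs_of_nonneg (mul_nonneg (selProb_nonneg _ _ _) h0)]
    exact mul_le_one₀ (selProb_le_one _ _ _) h0 (hω i).1.2.2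

lemma welfare_eq_sum (hπ : G.IsProfile π) :
    G.welfare π = ∑ i, ∫ p, G.interim π i p.2 * p.2 ∂(π i) := by
  have hprob : ∀ i, IsProbabilityMeasure (π i) := fun i => (hπ i).prob
  unfold welfare
  rw [integral_finsetSum _ fun i _ => integrable_selProb_mul_message hπ i]
  refine Finset.sum_congr rfl fun i _ => ?_
  exact G.integral_selProb_mul π i (fun p => p.2) measurable_snd ((hπ i).integrable_snd G.lo_pos)

lemma sum_integral_interim (hπ : G.IsProfile π) :
    ∑ i, ∫ p, G.interim π i p.2 ∂(π i) = k := by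
  have hprob : ∀ i, IsProbabilityMeasure (π i) := fun i => (hπ i).prob
  have h1 : ∀ i, ∫ p, G.interim π i p.2 ∂(π i) =
      ∫ ω, selProb k ω.observed i ∂(G.outcomeLaw π) := fun i => by
    have := G.integral_selProb_mul π i (fun _ => 1) measurable_const (integrable_const _)
    simpa using this.symm
  simp only [h1]
  rw [← integral_finsetSum]
  · simp only [sum_selProb k _ G.k_le_N]
    simp
  · intro i _
    refine Integrable.of_bound (C := 1)
      ((measurable_selProb k i).comp Outcome.measurable_observed).aestronglyMeasurable
      (ae_of_all _ fun ω => ?_)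
    rw [Real.norm_eq_abs, abs_of_nonneg (selProb_nonneg _ _ _)]
    exact selProb_le_one _ _ _

lemma welfare_pos (hπ : G.IsProfile π) : 0 < G.welfare π := by
  have hprob : ∀ i, IsProbabilityMeasure (π i) := fun i => (hπ i).prob
  have hk : (0 : ℝ) < k := by exact_mod_cast G.one_le_k
  refine lt_of_lt_of_le (mul_pos G.lo_pos hk) ?_
  rw [welfare_eq_sum hπ, ← sum_integral_interim hπ, Finset.mul_sum]
  refine Finset.sum_le_sum fun i _ => ?_
  have hb : ∀ᵐ p ∂(π i), ‖G.interim π i p.2‖ ≤ 1 := ae_of_all _ fun p => by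
    rw [Real.norm_eq_abs, abs_of_nonneg (G.interim_nonneg π i _)]
    exact G.interim_le_one π i _
  have hm : AEStronglyMeasurable (fun p : ℝ × ℝ => G.interim π i p.2) (π i) :=
    ((G.measurable_interim π i).comp measurable_snd).aestronglyMeasurable
  rw [← integral_const_mul]
  refine integral_mono_ae ((Integrable.of_bound hm 1 hb).const_mul _)
    (((hπ i).integrable_snd G.lo_pos).bdd_mul hm hb) ?_
  filter_upwards [(hπ i).supp] with p hp
  rw [mul_comm]
  exact mul_le_mul_of_nonneg_left hp.2.1 (G.interim_nonneg π i _)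

lemma measurableSet_le_card (k : ℕ) (s : ℝ) :
    MeasurableSet {ω : Outcome N | k ≤ (Finset.univ.filter fun j => s ≤ ω.observed j).card} := by
  have h := measurable_card_filter (fun (ω : Outcome N) j => s ≤ ω.observed j)
    fun j => measurableSet_le measurable_const
      ((measurable_pi_apply j).comp Outcome.measurable_observed)
  exact h (measurableSet_Ici (a := k))

/-- Markov's inequality for the `k`-th highest observation. -/
lemma measureReal_le_card_mul_le (hπ : G.IsProfile π) {s : ℝ} (hs : 0 ≤ s) :
    (G.outcomeLaw π).real
        {ω | k ≤ (Finset.univ.filter fun j => s ≤ ω.observed j).card} * (k * s) ≤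
      (1 + G.η) * G.welfare π := by
  have hprob : ∀ i, IsProbabilityMeasure (π i) := fun i => (hπ i).prob
  rw [← smul_eq_mul, ← integral_indicator_const _ (measurableSet_le_card k s), welfare,
    ← integral_const_mul]
  refine integral_mono_ae ((integrable_const _).indicator (measurableSet_le_card k s))
    ((integrable_finsetSum _ fun i _ => integrable_selProb_mul_message hπ i).const_mul _) ?_
  filter_upwards [hπ.ae_outcome] with ω hω
  have hη := G.η_pos
  have hη1 := G.η_lt_one
  have hterm : ∀ i, 0 ≤ ω.observed i ∧ ω.observed i ≤ (1 + G.η) * ω.message i := fun i => by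
    have h0 : 0 ≤ ω.message i := G.lo_pos.le.trans (hω i).1.2.1
    refine ⟨mul_nonneg h0 (by linarith [(hω i).2.1]), ?_⟩
    rw [mul_comm (1 + G.η)]
    exact mul_le_mul_of_nonneg_left (hω i).2.2 h0
  have hsel := selProb_nonneg k ω.observed
  -- Noise inflates a message by at most the factor `1 + η`, which turns selected observations into
  -- welfare.
  have hsum : ∑ i, selProb k ω.observed i * ω.observed i ≤
      (1 + G.η) * ∑ i, selProb k ω.observed i * ω.message i := by
    rw [Finset.mul_sum]
    refine Finset.sum_le_sum fun i _ => ?_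
    rw [mul_left_comm]
    exact mul_le_mul_of_nonneg_left (hterm i).2 (hsel i)
  refine le_trans ?_ hsum
  by_cases hE : k ≤ (Finset.univ.filter fun j => s ≤ ω.observed j).card
  · rw [Set.indicator_of_mem (by exact hE)]
    calc (k : ℝ) * s ≤ (∑ i with s ≤ ω.observed i, selProb k ω.observed i) * s :=
          mul_le_mul_of_nonneg_right (le_sum_selProb_of_le_card k _ s hE) hs
      _ ≤ ∑ i with s ≤ ω.observed i, selProb k ω.observed i * ω.observed i := by
          rw [Finset.sum_mul]
          refine Finset.sum_le_sum fun i hi => mul_le_mul_of_nonneg_left ?_ (hsel i)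
          simpa using hi
      _ ≤ ∑ i, selProb k ω.observed i * ω.observed i :=
          Finset.sum_le_sum_of_subset_of_nonneg (Finset.subset_univ _)
            fun i _ _ => mul_nonneg (hsel i) (hterm i).1
  · rw [Set.indicator_of_notMem (by exact hE)]
    exact Finset.sum_nonneg fun i _ => mul_nonneg (hsel i) (hterm i).1

/-- A message above `2 (1 + η) / (1 - η)` times the average welfare per slot is selected with
probability at least one half. -/
lemma half_le_interim (hπ : G.IsProfile π) (i : Fin N) {m : ℝ}
    (hm : 2 * ((1 + G.η) / (1 - G.η)) * (G.welfare π / k) ≤ m) : 1 / 2 ≤ G.interim π i m := by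
  have hprob : ∀ i, IsProbabilityMeasure (π i) := fun i => (hπ i).prob
  have hk : (0 : ℝ) < k := by exact_mod_cast G.one_le_k
  have hη := G.η_pos
  have hη1 : 0 < 1 - G.η := sub_pos.mpr G.η_lt_one
  have hW := welfare_pos hπ
  -- Chosen so that `k s` is twice the Markov bound `(1 + η) W`; the assumption on `m` says that
  -- even the lowest noise `1 - η` leaves `m` at `s` or above.
  set s : ℝ := 2 * (1 + G.η) * (G.welfare π / k) with hs
  have hs0 : 0 < s := by positivity
  have hsm : s ≤ m * (1 - G.η) := by
    have h := mul_le_mul_of_nonneg_right hm hη1.le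
    refine le_trans (le_of_eq ?_) h
    rw [hs]
    field_simp
  have hm0 : 0 ≤ m := le_trans (by positivity) hm
  set E : Set (Outcome N) :=
    {ω | k ≤ (Finset.univ.filter fun j => s ≤ ω.observed j).card} with hE
  have hEm : MeasurableSet E := measurableSet_le_card k s
  have hPE : (G.outcomeLaw π).real E ≤ 1 / 2 := by
    have h1 := measureReal_le_card_mul_le hπ hs0.le
    have h2 : (k : ℝ) * s = 2 * ((1 + G.η) * G.welfare π) := by
      rw [hs]
      field_simp
    rw [h2] at h1
    have h3 : 0 < (1 + G.η) * G.welfare π := by positivity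
    change (G.outcomeLaw π).real E * _ ≤ _ at h1
    refine le_of_mul_le_mul_right ?_ h3
    linarith
  have hinner : ∀ ξ ∈ Set.Icc (1 - G.η) (1 + G.η), 1 / 2 ≤
      ∫ ω : Outcome N, selProb k (Function.update ω.observed i (m * ξ)) i ∂(G.outcomeLaw π) := by
    intro ξ hξ
    calc (1 : ℝ) / 2 ≤ (G.outcomeLaw π).real Eᶜ := by
          rw [probReal_compl_eq_one_sub hEm]
          linarith
      _ = ∫ ω, Eᶜ.indicator (fun _ => (1 : ℝ)) ω ∂(G.outcomeLaw π) := by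
          rw [integral_indicator_const _ hEm.compl, smul_eq_mul, mul_one]
      _ ≤ _ := by
          refine integral_mono ((integrable_const _).indicator hEm.compl) ?_ fun ω => ?_
          · refine Integrable.of_bound (C := 1) ?_ (ae_of_all _ fun ω => ?_)
            · exact ((measurable_selProb_update (k := k) i).comp
                (measurable_id.prodMk (measurable_const (a := (m, ξ))))).aestronglyMeasurable
            · rw [Real.norm_eq_abs, abs_of_nonneg (selProb_nonneg _ _ _)]
              exact selProb_le_one _ _ _
          · by_cases hω : ω ∈ E
            · simpa [hω] using selProb_nonneg k _ i
            · rw [Set.indicator_of_mem (by exact hω), selProb_update_eq_one k ω.observed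
                (hsm.trans (mul_le_mul_of_nonneg_left hξ.1 hm0)) (not_le.mp hω)]
  unfold interim
  calc (1 : ℝ) / 2 = ∫ _, 1 / 2 ∂(noise G.η) := by simp
    _ ≤ _ := by
      refine integral_mono_ae (integrable_const _) ?_ ?_
      · refine Integrable.of_bound (C := 1) ?_ (ae_of_all _ fun ξ => ?_)
        · have h1 : StronglyMeasurable fun x : ℝ × ℝ => ∫ ω : Outcome N,
              selProb k (Function.update ω.observed i (x.1 * x.2)) i ∂(G.outcomeLaw π) :=
            (measurable_selProb_update (k := k) i).stronglyMeasurable.integral_prod_left'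
          exact (h1.comp_measurable (measurable_prodMk_left (x := m))).aestronglyMeasurable
        · rw [Real.norm_eq_abs, abs_of_nonneg (integral_nonneg fun _ => selProb_nonneg _ _ _)]
          refine (integral_mono_of_nonneg (ae_of_all _ fun _ => selProb_nonneg _ _ _)
            (integrable_const (1 : ℝ)) (ae_of_all _ fun _ => selProb_le_one _ _ _)).trans ?_
          simp
      · filter_upwards [ae_noise_mem G.η] with ξ hξ using hinner ξ hξ

/-- Values lie in `[lo, 1]` almost surely, so clamping changes nothing; it makes the utility
continuous on the whole line, where `G.u i` is otherwise arbitrary. -/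
lemma utility_update (hπ : G.IsProfile π) (i : Fin N) {π' : Measure (ℝ × ℝ)}
    (h : IsSignalingScheme G.lo (G.prior i) π') :
    G.utility (Function.update π i π') i =
      ∫ p, G.interim π i p.2 * G.u i (clamp G.lo p.1) ∂π' := by
  have hprob : ∀ i, IsProbabilityMeasure (π i) := fun i => (hπ i).prob
  have := h.prob
  obtain ⟨C, hC⟩ := exists_bound_comp_clamp h.lo_le_one (G.u_cont i)
  have hum : Measurable fun p : ℝ × ℝ => G.u i (clamp G.lo p.1) :=
    (continuous_comp_clamp h.lo_le_one (G.u_cont i)).measurable.comp measurable_fst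
  rw [← G.integral_selProb_mul_update π i π' (fun p => G.u i (clamp G.lo p.1)) hum
    (Integrable.of_bound hum.aestronglyMeasurable C (ae_of_all _ fun p => hC _))]
  refine integral_congr_ae ?_
  filter_upwards [(hπ.update h).ae_outcome] with ω hω
  rw [← clamp_of_mem (hω i).1.1]
  simp only [Outcome.value]

lemma integral_prior_excess_le (h : G.IsNash π) (i : Fin N) {T : ℝ} (hT : 0 < T)
    (hgT : ∀ m, T ≤ m → 1 / 2 ≤ G.interim π i m) :
    ∫ v, max 0 (v - T) ∂(G.prior i) ≤
      2 * ∫ p, G.interim π i p.2 * p.2 ∂(π i) + 2 * T * ∫ p, G.interim π i p.2 ∂(π i) := by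
  have hprob : ∀ i, IsProbabilityMeasure (π i) := fun i => (h.1 i).prob
  have hlo1 := (h.1 i).lo_le_one
  rw [← (h.1 i).map_fst, integral_map measurable_fst.aemeasurable (by fun_prop)]
  refine integral_excess_le (u := fun v => G.u i (clamp G.lo v)) (h.1 i) G.lo_pos
    (G.measurable_interim π i) (G.interim_nonneg π i) (G.interim_le_one π i)
    (continuous_comp_clamp hlo1 (G.u_cont i)) (fun x y hxy => ?_)
    (fun v => G.u_pos i _ (clamp_mem hlo1 v)) hT hgT fun π' hπ' => ?_
  · exact G.u_mono i (clamp_mem hlo1 x) (clamp_mem hlo1 y) (monotone_clamp G.lo hxy)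
  · have h1 := h.2 i π' hπ'
    rw [utility_update h.1 i hπ'] at h1
    have h2 := utility_update h.1 i (h.1 i)
    rw [Function.update_eq_self] at h2
    rwa [h2] at h1

/-- The best `k` values exceed `k T` by at most the total excess over `T`. -/
lemma firstBest_le (G : Game N k) {T : ℝ} (hT : 0 ≤ T) :
    G.firstBest ≤ k * T + ∑ i, ∫ v, max 0 (v - T) ∂(G.prior i) := by
  have hprob := G.prior_prob
  have hint : ∀ i, Integrable (fun v : ℝ => max 0 (v - T)) (G.prior i) := fun i => by
    refine Integrable.of_bound (C := 1) (by fun_prop) ?_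
    filter_upwards [G.prior_supp i] with v hv
    rw [Real.norm_eq_abs, abs_of_nonneg (le_max_left _ _)]
    exact max_le zero_le_one (by linarith [hv.2])
  have hint' : ∀ i, Integrable (fun v : Fin N → ℝ => max 0 (v i - T)) (Measure.pi G.prior) :=
    fun i => (measurePreserving_eval G.prior i).integrable_comp_of_integrable (hint i)
  have heval : ∀ i, ∫ v, max 0 (v - T) ∂(G.prior i) =
      ∫ v : Fin N → ℝ, max 0 (v i - T) ∂(Measure.pi G.prior) := fun i =>
    (integral_comp_eval (μ := G.prior) (f := fun v : ℝ => max 0 (v - T)) (hint i).1).symm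
  simp only [heval]
  rw [← integral_finsetSum _ fun i _ => hint' i]
  have hconst : (k : ℝ) * T = ∫ _ : Fin N → ℝ, (k : ℝ) * T ∂(Measure.pi G.prior) := by simp
  rw [hconst, ← integral_add (integrable_const _) (integrable_finsetSum _ fun i _ => hint' i)]
  obtain ⟨S₀, -, hS₀⟩ := Finset.exists_subset_card_eq
    (s := (Finset.univ : Finset (Fin N))) (n := k) (by simpa using G.k_le_N)
  have : Nonempty {S : Finset (Fin N) // S.card = k} := ⟨⟨S₀, hS₀⟩⟩
  -- Nonnegativity of the maximum stands in for its integrability.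
  refine integral_mono_of_nonneg ?_ ((integrable_const _).add
    (integrable_finsetSum _ fun i _ => hint' i)) (ae_of_all _ fun v => ?_)
  · have hpos : ∀ᵐ v ∂(Measure.pi G.prior), ∀ i, 0 ≤ v i := by
      rw [ae_all_iff]
      intro i
      exact (Measure.tendsto_eval_ae_ae (μ := G.prior) (i := i)).eventually
        ((G.prior_supp i).mono fun v hv => G.lo_pos.le.trans hv.1)
    filter_upwards [hpos] with v hv
    exact Real.iSup_nonneg fun S => Finset.sum_nonneg fun i _ => hv i
  · refine ciSup_le fun S => ?_
    calc ∑ i ∈ S.1, v i ≤ ∑ i ∈ S.1, (T + max 0 (v i - T)) := by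
          refine Finset.sum_le_sum fun i _ => ?_
          linarith [le_max_right (0 : ℝ) (v i - T)]
      _ = k * T + ∑ i ∈ S.1, max 0 (v i - T) := by
          rw [Finset.sum_add_distrib, Finset.sum_const, S.2, nsmul_eq_mul]
      _ ≤ k * T + ∑ i, max 0 (v i - T) := by
          refine add_le_add le_rfl ?_
          exact Finset.sum_le_sum_of_subset_of_nonneg (Finset.subset_univ _)
            fun i _ _ => le_max_left _ _

/-- The first-best welfare is at most `8 (1 + η) / (1 - η)` times the welfare of an equilibrium. -/
lemma IsNash.firstBest_le (h : G.IsNash π) :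
    G.firstBest ≤ 8 * ((1 + G.η) / (1 - G.η)) * G.welfare π := by
  have hk : (0 : ℝ) < k := by exact_mod_cast G.one_le_k
  have hη := G.η_pos
  have hη1 : 0 < 1 - G.η := sub_pos.mpr G.η_lt_one
  have hW := welfare_pos h.1
  set r := (1 + G.η) / (1 - G.η) with hr
  have hr1 : 1 ≤ r := by
    rw [hr, one_le_div hη1]
    linarith
  -- The lowest message for which `half_le_interim` applies.
  set T := 2 * r * (G.welfare π / k) with hTdef
  have hT : 0 < T := by positivity
  have hkT : k * T = 2 * r * G.welfare π := by
    rw [hTdef]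
    field_simp
  have hsum : ∑ i, ∫ v, max 0 (v - T) ∂(G.prior i) ≤ 2 * G.welfare π + 2 * T * k := by
    rw [welfare_eq_sum h.1, ← sum_integral_interim h.1, Finset.mul_sum, Finset.mul_sum,
      ← Finset.sum_add_distrib]
    exact Finset.sum_le_sum fun i _ => integral_prior_excess_le h i hT
      fun m hm => half_le_interim h.1 i hm
  have hfb := G.firstBest_le hT.le
  have h1 : G.welfare π ≤ r * G.welfare π := le_mul_of_one_le_left hW.le hr1
  linarith

end Game
end NoisyPersuasion

theorem mainTheorem6 {N k : ℕ} (G : NoisyPersuasion.Game N k) :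
    G.priceOfAnarchy ≤
      ENNReal.ofReal ((11 + 5 * Real.sqrt 5) * ((1 + G.η) / (1 - G.η)) ^ 2) := by
  have hη := G.η_pos
  have hη1 : 0 < 1 - G.η := sub_pos.mpr G.η_lt_one
  have hr1 : 1 ≤ (1 + G.η) / (1 - G.η) := by
    rw [one_le_div hη1]
    linarith
  -- Crude slack: `8 ≤ 11` and `r ≤ r ^ 2`, as `r ≥ 1`.
  have hC : 8 * ((1 + G.η) / (1 - G.η)) ≤
      (11 + 5 * Real.sqrt 5) * ((1 + G.η) / (1 - G.η)) ^ 2 := by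
    refine mul_le_mul ?_ (le_self_pow₀ hr1 two_ne_zero) (by positivity) (by positivity)
    linarith [Real.sqrt_nonneg 5]
  have hC0 : 0 < 8 * ((1 + G.η) / (1 - G.η)) := by positivity
  refine le_trans ?_ (ENNReal.ofReal_le_ofReal hC)
  have hC0' : ENNReal.ofReal (8 * ((1 + G.η) / (1 - G.η))) ≠ 0 := by
    simpa using hC0
  unfold NoisyPersuasion.Game.priceOfAnarchy
  -- Rewriting the ratio bound as a lower bound on the infimum allows one equilibrium to be treated
  -- at a time and covers the case of no equilibrium.
  refine ENNReal.div_le_of_le_mul' ?_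
  rw [← ENNReal.div_le_iff_le_mul (Or.inl hC0') (Or.inl ENNReal.ofReal_ne_top)]
  refine le_iInf₂ fun π hπ => ?_
  rw [ENNReal.div_le_iff_le_mul (Or.inl hC0') (Or.inl ENNReal.ofReal_ne_top), mul_comm,
    ← ENNReal.ofReal_mul hC0.le]
  exact ENNReal.ofReal_le_ofReal hπ.firstBest_le
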